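/- Let $\mathbb{K}$ be a field of characteristic zero, $S=\mathbb{K}[x_1,\dots,x_n]$ the standard graded polynomial ring, and $I\subset S$ an ideal that contains no nonzero linear form and is generated by a regular sequence of homogeneous polynomials, so that $A=S/I$ is a (graded) complete intersection. Suppose that $A$ has $H$-vector $(1,4,k,k,4,1)$ for some integer $k$; that is, the numbers in this list are positive, $\dim_{\mathbb{K}}A_i$ for $i=0,\dots,5$ are these numbers, and $A_i=0$ for $i>5$. Then the $H$-vector of $A$ is $(1,4,7,7,4,1)$. Moreover $A$ has a minimal graded finite free resolution $0\to F_p\to\cdots\to F_0\to A\to 0$ over $S$, and in every such resolution, with $F_i\cong\bigoplus_{j\in\mathbb{Z}} S(-j)^{b_{i,j}}$, the Betti numbers $b_{i,i+j}$ are given by the Betti table (column $i$, row $j$, all entries that are not shown being zero) $$\begin{array}{c|ccccc} & 0&1&2&3&4\\ \hline 0&1&0&0&0&0\\ 1&0&3&0&0&0\\ 2&0&1&3&0&0\\ 3&0&0&3&1&0\\ 4&0&0&0&3&0\\ 5&0&0&0&0&1\end{array}$$ In particular the ranks of $F_0,\dots,F_4$ are $1,4,6,4,1$, and $F_i=0$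 for $i>4$. (This is the table of the Koszul complex on four forms of degrees $2,2,2,3$.) The table is realized: for every field $\mathbb{K}$ of characteristic zero, the ideal $I=(x_1^2,x_2^2,x_3^2,x_4^3)$ of $\mathbb{K}[x_1,x_2,x_3,x_4]$ contains no nonzero linear form, $S/I$ is a complete intersection with $H$-vector $(1,4,7,7,4,1)$, and its Betti table is the one above. -/

import Mathlib

open MvPolynomial

/-- The graded piece `S_t`, `t ∈ ℤ`, of the standard graded polynomial ring
`S = K[x_1, …, x_n]`; it is zero for `t < 0`. -/
noncomputable def polyPiece (K : Type*) [Field K] (n : ℕ) : ℤ → Submodule K (MvPolynomial (Fin n) K)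
  | Int.ofNat d => homogeneousSubmodule (Fin n) K d
  | Int.negSucc _ => ⊥

/-- The graded piece `A_t` of the algebra `A = S/I`: the image of `S_t`. -/
noncomputable def quotPiece {K : Type*} [Field K] {n : ℕ} (I : Ideal (MvPolynomial (Fin n) K))
    (t : ℤ) : Submodule K (MvPolynomial (Fin n) K ⧸ I) :=
  (polyPiece K n t).map (Ideal.Quotient.mkₐ K I).toLinearMap

/-- The Hilbert function `H(A, t) = dim_K A_t` of `A = S/I`. -/
noncomputable def hilbertFn {K : Type*} [Field K] {n : ℕ} (I : Ideal (MvPolynomial (Fin n) K))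
    (t : ℤ) : ℕ :=
  Module.finrank K (quotPiece I t)

/-- `A = S/I` has `H`-vector `(h_0, h_1, …, h_s)`: all `h_i` are positive, `H(A, i) = h_i` for
`0 ≤ i ≤ s`, and `H(A, i) = 0` for `i > s`. (For negative `i` always `H(A, i) = 0`.) -/
def HasHVector {K : Type*} [Field K] {n : ℕ} (I : Ideal (MvPolynomial (Fin n) K))
    (h : List ℕ) : Prop :=
  (∀ a ∈ h, 0 < a) ∧ ∀ i : ℕ, hilbertFn I (i : ℤ) = h.getD i 0

/-- The ideal `I` contains no non-zero linear form. -/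
def IsNondegenerate {K : Type*} [Field K] {n : ℕ} (I : Ideal (MvPolynomial (Fin n) K)) : Prop :=
  ∀ l ∈ I, l.IsHomogeneous 1 → l = 0

/-- `S/I` is a (graded) complete intersection: `I` is generated by a regular sequence of
homogeneous polynomials. -/
def IsCompleteIntersection {K : Type*} [Field K] {n : ℕ}
    (I : Ideal (MvPolynomial (Fin n) K)) : Prop :=
  ∃ fs : List (MvPolynomial (Fin n) K),
    (∀ f ∈ fs, ∃ d : ℕ, f.IsHomogeneous d) ∧
    RingTheory.Sequence.IsRegular (MvPolynomial (Fin n) K) fs ∧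
    I = Ideal.ofList fs

/-- The degree `t` piece of the graded free module `⨁_k S(-δ_k)`, where `S(-δ)_t = S_{t-δ}`. -/
noncomputable def freePiece (K : Type*) [Field K] (n : ℕ) {r : ℕ} (δ : Fin r → ℤ) (t : ℤ) :
    Submodule K (Fin r → MvPolynomial (Fin n) K) :=
  Submodule.pi Set.univ fun k => polyPiece K n (t - δ k)

/-- A minimal graded finite free resolution
`0 ⟶ F_N ⟶ ⋯ ⟶ F_1 ⟶ F_0 ⟶ S/I ⟶ 0` of the graded `S`-module `S/I`, with
`F_i = ⨁_k S(-shift i k)`. All maps are `S`-linear and preserve degrees, and minimality means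
that the image of each differential lies in `𝔪 F_i` with `𝔪 = (x_1, …, x_n)`. -/
structure MinimalGradedResolution {K : Type*} [Field K] {n : ℕ}
    (I : Ideal (MvPolynomial (Fin n) K)) where
  /-- the rank of `F_i` -/
  rank : ℕ → ℕ
  /-- the degrees of the basis elements of `F_i` -/
  shift : ∀ i, Fin (rank i) → ℤ
  /-- the differential `F_{i+1} ⟶ F_i` -/
  d : ∀ i, (Fin (rank (i + 1)) → MvPolynomial (Fin n) K) →ₗ[MvPolynomial (Fin n) K]
    (Fin (rank i) → MvPolynomial (Fin n) K)
  /-- the augmentation `F_0 ⟶ S/I` -/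
  aug : (Fin (rank 0) → MvPolynomial (Fin n) K) →ₗ[MvPolynomial (Fin n) K]
    (MvPolynomial (Fin n) K ⧸ I)
  rank_eventually_zero : ∃ N, ∀ i, N < i → rank i = 0
  d_graded : ∀ i t, ∀ v ∈ freePiece K n (shift (i + 1)) t, d i v ∈ freePiece K n (shift i) t
  aug_graded : ∀ t, ∀ v ∈ freePiece K n (shift 0) t, aug v ∈ quotPiece I t
  aug_surjective : Function.Surjective aug
  exact_aug : Function.Exact (d 0) aug
  exact_d : ∀ i, Function.Exact (d (i + 1)) (d i)
  minimal : ∀ i v k, d i v k ∈ Ideal.span (Set.range (X : Fin n → MvPolynomial (Fin n) K))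

/-- The number `b_{i,j}` of summands `S(-j)` of `F_i`. -/
def MinimalGradedResolution.betti {K : Type*} [Field K] {n : ℕ}
    {I : Ideal (MvPolynomial (Fin n) K)} (F : MinimalGradedResolution I) (i : ℕ) (j : ℤ) : ℕ :=
  (Finset.univ.filter fun k : Fin (F.rank i) => F.shift i k = j).card

/-- The entry in row `j` and column `i` of a finite table, zero outside the table. -/
def tableEntry {r c : ℕ} (T : Matrix (Fin r) (Fin c) ℕ) (i : ℕ) (j : ℤ) : ℕ :=
  if h : i < c ∧ 0 ≤ j ∧ j.toNat < r then T ⟨j.toNat, h.2.2⟩ ⟨i, h.1⟩ else 0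

/-- `S/I` has Betti table `T`: the entry in column `i` and row `j` is `b_{i,i+j}`, and the other
Betti numbers vanish. A minimal graded free resolution is required to exist, and every one of them
has to have these Betti numbers. -/
def HasBettiTable {K : Type*} [Field K] {n : ℕ} (I : Ideal (MvPolynomial (Fin n) K))
    {r c : ℕ} (T : Matrix (Fin r) (Fin c) ℕ) : Prop :=
  Nonempty (MinimalGradedResolution I) ∧
    ∀ F : MinimalGradedResolution I, ∀ (i : ℕ) (j : ℤ), F.betti i (i + j) = tableEntry T i j

/-- `S/I` has total Betti numbers `(b_0, …, b_p)`: in every minimal graded free resolution (and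
there is one), `F_i` has rank `b_i` for `i ≤ p` and `F_i = 0` for `i > p`. -/
def HasTotalBettiNumbers {K : Type*} [Field K] {n : ℕ} (I : Ideal (MvPolynomial (Fin n) K))
    (b : List ℕ) : Prop :=
  Nonempty (MinimalGradedResolution I) ∧
    ∀ F : MinimalGradedResolution I, ∀ i : ℕ, F.rank i = b.getD i 0

/-- The Betti table of the Koszul complex on four forms of degrees `2, 2, 2, 3`; columns are the
homological degrees `0, …, 4`, rows are `0, …, 5`. -/
def koszulTable2223 : Matrix (Fin 6) (Fin 5) ℕ :=
  !![1, 0, 0, 0, 0;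
     0, 3, 0, 0, 0;
     0, 1, 3, 0, 0;
     0, 0, 3, 1, 0;
     0, 0, 0, 3, 0;
     0, 0, 0, 0, 1]

/-- The ideal `(x_1^2, x_2^2, x_3^2, x_4^3)` of `K[x_1, x_2, x_3, x_4]`. -/
noncomputable def monomialCI (K : Type*) [Field K] : Ideal (MvPolynomial (Fin 4) K) :=
  Ideal.span {X 0 ^ 2, X 1 ^ 2, X 2 ^ 2, X 3 ^ 3}

/-!
Both halves rest on one description of graded complete intersections, `IsGradedCI J ds`: the ideal
`J` arises from `0` by adding one form at a time, each a non-zero-divisor modulo the previous ones,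
and `ds` lists the degrees.

*Degrees.* A non-zero-divisor of degree `d` multiplies the Hilbert series by `1 - X^d`
(`hilbertSeries_sup`). Applied to the regular sequence `x_1, …, x_n`, this gives the Hilbert series
`(1 - X)^{-n}` of `S`; applied to `J`, it gives `(1 - X)^n HS(S/J) = ∏ (1 - X^d)`
(`IsGradedCI.one_sub_X_pow_mul_hilbertSeries`). If `HS(S/I) = 1 + 4X + kX² + kX³ + 4X⁴ + X⁵`, its
value at `1` is positive, so there are exactly `n` generators and
`HS(S/I) = ∏ (1 + X + ⋯ + X^{d-1})`. All degrees are at least `2` because `I` contains no linear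
form, so the coefficient of `X` is the number of generators, which is therefore `4`. Comparing the
degrees of the polynomials gives `∑ d = 9`, hence the degrees are `2, 2, 2, 3`, and the value at `1`
gives `10 + 2k = 24` (`IsGradedCI.perm_and_eq`).

*Existence of the resolution.* If `F` is a minimal resolution of `S/J`, the mapping cone of
`f : F(-d) ⟶ F` is a minimal resolution of `S/(J + (f))` (`MinimalGradedResolution.cone`). Iterating
this from `S/0` yields the Koszul complex, with ranks and Betti numbers computed recursively
(`IsGradedCI.exists_resolution`).

*Uniqueness of the Betti numbers.* Two minimal graded free covers `a`, `b` of the same module are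
isomorphic: lifting each along the other gives graded maps `φ`, `ψ`, and `ψ φ - 1` has image in
`ker a ⊆ 𝔪 F`. A graded endomorphism with image in `𝔪 F` strictly lowers the shifts, so it is
nilpotent and `ψ φ` is invertible (`exists_gradedEquiv_of_minimal`). By induction on the
homological degree, any two minimal resolutions are termwise isomorphic as graded modules
(`MinimalGradedResolution.exists_gradedEquiv`), and reduction modulo `𝔪` shows that isomorphic
graded free modules have the same shifts (`card_shift_eq_of_gradedEquiv`).
-/

open MvPolynomial

section

variable {K : Type*} [Field K] {n : ℕ}

/-! ### Graded pieces of the polynomial ring -/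

/-- The projection of `S` onto its graded piece `S_t`, `t ∈ ℤ`. -/
noncomputable def polyComp (t : ℤ) : MvPolynomial (Fin n) K →ₗ[K] MvPolynomial (Fin n) K :=
  match t with
  | Int.ofNat d => homogeneousComponent d
  | Int.negSucc _ => 0

theorem mem_polyPiece_natCast {d : ℕ} {p : MvPolynomial (Fin n) K} :
    p ∈ polyPiece K n (d : ℤ) ↔ p.IsHomogeneous d := Iff.rfl

theorem eq_zero_of_mem_polyPiece_neg {t : ℤ} (ht : t < 0) {p : MvPolynomial (Fin n) K}
    (hp : p ∈ polyPiece K n t) : p = 0 := by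
  obtain ⟨d, rfl⟩ := Int.eq_negSucc_of_lt_zero ht
  exact (Submodule.mem_bot K).1 hp

theorem polyComp_neg {t : ℤ} (ht : t < 0) (p : MvPolynomial (Fin n) K) : polyComp t p = 0 := by
  obtain ⟨d, rfl⟩ := Int.eq_negSucc_of_lt_zero ht
  rfl

theorem polyComp_natCast (d : ℕ) (p : MvPolynomial (Fin n) K) :
    polyComp (d : ℤ) p = homogeneousComponent d p := rfl

theorem polyComp_mem (t : ℤ) (p : MvPolynomial (Fin n) K) : polyComp t p ∈ polyPiece K n t := by
  cases t with
  | ofNat d => exact homogeneousComponent_isHomogeneous d p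
  | negSucc d => exact Submodule.zero_mem _

theorem polyComp_of_mem {t : ℤ} {p : MvPolynomial (Fin n) K} (hp : p ∈ polyPiece K n t) :
    polyComp t p = p := by
  cases t with
  | ofNat d => exact homogeneousComponent_eq_self hp
  | negSucc d => exact ((Submodule.mem_bot K).1 hp).symm

theorem mul_mem_polyPiece {s t : ℤ} {p q : MvPolynomial (Fin n) K} (hp : p ∈ polyPiece K n s)
    (hq : q ∈ polyPiece K n t) : p * q ∈ polyPiece K n (s + t) := by
  rcases lt_or_ge s 0 with hs | hs
  · rw [eq_zero_of_mem_polyPiece_neg hs hp, zero_mul]; exact Submodule.zero_mem _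
  rcases lt_or_ge t 0 with ht | ht
  · rw [eq_zero_of_mem_polyPiece_neg ht hq, mul_zero]; exact Submodule.zero_mem _
  lift s to ℕ using hs
  lift t to ℕ using ht
  exact_mod_cast IsHomogeneous.mul hp hq

theorem homogeneousComponent_mul_right {i m : ℕ} {f : MvPolynomial (Fin n) K}
    (hf : f.IsHomogeneous i) (p : MvPolynomial (Fin n) K) :
    homogeneousComponent m (p * f) = if i ≤ m then homogeneousComponent (m - i) p * f else 0 := by
  let _ : DirectSum.Decomposition (homogeneousSubmodule (Fin n) K) := decomposition
  let _ : GradedRing (homogeneousSubmodule (Fin n) K) := { HomogeneousSubmodule.gradedMonoid with }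
  have key : ∀ (q : MvPolynomial (Fin n) K) (j : ℕ),
    (DirectSum.decompose (homogeneousSubmodule (Fin n) K) q j : MvPolynomial (Fin n) K) =
      homogeneousComponent j q := fun q j => decomposition.decompose'_apply q j
  rw [← key, ← key]
  split_ifs with h
  · exact DirectSum.coe_decompose_mul_of_right_mem_of_le _ hf h
  · exact DirectSum.coe_decompose_mul_of_right_mem_of_not_le _ hf h

theorem polyComp_mul_right {u : ℤ} {f : MvPolynomial (Fin n) K} (hf : f ∈ polyPiece K n u) (t : ℤ)
    (p : MvPolynomial (Fin n) K) : polyComp t (p * f) = polyComp (t - u) p * f := by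
  rcases lt_or_ge u 0 with hu | hu
  · simp [eq_zero_of_mem_polyPiece_neg hu hf]
  lift u to ℕ using hu
  rcases lt_or_ge t 0 with ht | ht
  · rw [polyComp_neg ht, polyComp_neg (by omega), zero_mul]
  lift t to ℕ using ht
  rw [polyComp_natCast, homogeneousComponent_mul_right hf]
  split_ifs with h
  · rw [← Nat.cast_sub h, polyComp_natCast]
  · rw [polyComp_neg (by omega), zero_mul]

/-! ### Graded free modules -/

/-- The ideal `(x_1, …, x_n)`. -/
noncomputable abbrev irrelevant (K : Type*) [Field K] (n : ℕ) : Ideal (MvPolynomial (Fin n) K) :=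
  Ideal.span (Set.range (X : Fin n → MvPolynomial (Fin n) K))

theorem mem_irrelevant_iff {p : MvPolynomial (Fin n) K} :
    p ∈ irrelevant K n ↔ constantCoeff p = 0 := by
  rw [irrelevant, ← Set.image_univ, mem_ideal_span_X_image]
  constructor
  · intro h
    by_contra h0
    obtain ⟨i, -, hi⟩ := h 0 (mem_support_iff.2 h0)
    exact hi rfl
  · intro h m hm
    by_contra! h0
    have : m = 0 := by ext i; exact h0 i trivial
    subst this
    exact mem_support_iff.1 hm h

theorem constantCoeff_eq_zero_of_mem_polyPiece {t : ℤ} (ht : t ≠ 0) {p : MvPolynomial (Fin n) K}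
    (hp : p ∈ polyPiece K n t) : constantCoeff p = 0 := by
  rcases lt_or_ge t 0 with h | h
  · rw [eq_zero_of_mem_polyPiece_neg h hp, map_zero]
  lift t to ℕ using h
  exact IsHomogeneous.coeff_eq_zero hp (by simpa using fun h => ht (by simp [← h]))

theorem eq_zero_of_mem_polyPiece_of_mem_irrelevant {t : ℤ} (ht : t ≤ 0)
    {p : MvPolynomial (Fin n) K} (hp : p ∈ polyPiece K n t) (hm : p ∈ irrelevant K n) : p = 0 := by
  rcases ht.lt_or_eq with h | rfl
  · exact eq_zero_of_mem_polyPiece_neg h hp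
  have h0 : polyComp 0 p = C (coeff 0 p) := homogeneousComponent_zero p
  rw [← polyComp_of_mem hp, h0, show coeff 0 p = 0 from mem_irrelevant_iff.1 hm, C_0]

variable {r s : ℕ} {δ : Fin r → ℤ} {ε : Fin s → ℤ}

theorem mem_freePiece {t : ℤ} {v : Fin r → MvPolynomial (Fin n) K} :
    v ∈ freePiece K n δ t ↔ ∀ k, v k ∈ polyPiece K n (t - δ k) := by
  simp [freePiece, Submodule.mem_pi]

theorem single_mem_freePiece (δ : Fin r → ℤ) (k : Fin r) :
    (Pi.single k 1 : Fin r → MvPolynomial (Fin n) K) ∈ freePiece K n δ (δ k) := by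
  rw [mem_freePiece]
  intro l
  rcases eq_or_ne l k with rfl | h
  · rw [Pi.single_eq_same, sub_self]
    exact isHomogeneous_one _ _
  · rw [Pi.single_eq_of_ne h]
    exact Submodule.zero_mem _

theorem apply_eq_sum_single {M : Type*} [AddCommGroup M] [Module (MvPolynomial (Fin n) K) M]
    (a : (Fin r → MvPolynomial (Fin n) K) →ₗ[MvPolynomial (Fin n) K] M)
    (v : Fin r → MvPolynomial (Fin n) K) : a v = ∑ k, v k • a (Pi.single k 1) := by
  conv_lhs => rw [pi_eq_sum_univ' v]
  simp [map_sum]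

/-- The projection of `⨁_k S(-δ_k)` onto its degree `t` piece. -/
noncomputable def freeComp (δ : Fin r → ℤ) (t : ℤ) (v : Fin r → MvPolynomial (Fin n) K) :
    Fin r → MvPolynomial (Fin n) K :=
  fun k => polyComp (t - δ k) (v k)

theorem freeComp_mem (δ : Fin r → ℤ) (t : ℤ) (v : Fin r → MvPolynomial (Fin n) K) :
    freeComp δ t v ∈ freePiece K n δ t :=
  mem_freePiece.2 fun k => polyComp_mem _ (v k)

theorem freeComp_of_mem {t : ℤ} {v : Fin r → MvPolynomial (Fin n) K}
    (hv : v ∈ freePiece K n δ t) : freeComp δ t v = v :=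
  funext fun k => polyComp_of_mem (mem_freePiece.1 hv k)

/-- A linear map `⨁_k S(-δ_k) ⟶ ⨁_l S(-ε_l)` preserves degrees. -/
def IsGradedMap (δ : Fin r → ℤ) (ε : Fin s → ℤ)
    (a : (Fin r → MvPolynomial (Fin n) K) →ₗ[MvPolynomial (Fin n) K]
      (Fin s → MvPolynomial (Fin n) K)) : Prop :=
  ∀ t, ∀ v ∈ freePiece K n δ t, a v ∈ freePiece K n ε t

theorem IsGradedMap.of_single {a : (Fin r → MvPolynomial (Fin n) K) →ₗ[MvPolynomial (Fin n) K]
      (Fin s → MvPolynomial (Fin n) K)}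
    (h : ∀ k, a (Pi.single k 1) ∈ freePiece K n ε (δ k)) : IsGradedMap δ ε a := by
  intro t v hv
  rw [apply_eq_sum_single a v]
  refine Submodule.sum_mem _ fun k _ => mem_freePiece.2 fun l => ?_
  have := mul_mem_polyPiece (mem_freePiece.1 hv k) (mem_freePiece.1 (h k) l)
  rwa [sub_add_sub_cancel] at this

/-- Graded maps commute with the projections onto the graded pieces, so an element of degree `t` in
the image has a preimage of degree `t`. -/
theorem IsGradedMap.apply_freeComp {a : (Fin r → MvPolynomial (Fin n) K) →ₗ[MvPolynomial (Fin n) K]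
      (Fin s → MvPolynomial (Fin n) K)} (h : IsGradedMap δ ε a) (t : ℤ)
    (v : Fin r → MvPolynomial (Fin n) K) : a (freeComp δ t v) = freeComp ε t (a v) := by
  funext l
  rw [freeComp, apply_eq_sum_single a v, apply_eq_sum_single a (freeComp δ t v)]
  simp only [Finset.sum_apply, Pi.smul_apply, smul_eq_mul, map_sum]
  refine Finset.sum_congr rfl fun k _ => ?_
  have hk := mem_freePiece.1 (h _ _ (single_mem_freePiece δ k)) l
  rw [polyComp_mul_right hk, freeComp, sub_sub_sub_cancel_right]

theorem IsGradedMap.comp {r₃ : ℕ} {η : Fin r₃ → ℤ}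
    {b : (Fin s → MvPolynomial (Fin n) K) →ₗ[MvPolynomial (Fin n) K]
      (Fin r₃ → MvPolynomial (Fin n) K)}
    {a : (Fin r → MvPolynomial (Fin n) K) →ₗ[MvPolynomial (Fin n) K]
      (Fin s → MvPolynomial (Fin n) K)} (hb : IsGradedMap ε η b) (ha : IsGradedMap δ ε a) :
    IsGradedMap δ η (b ∘ₗ a) :=
  fun t v hv => hb t _ (ha t v hv)

theorem IsGradedMap.symm {e : (Fin r → MvPolynomial (Fin n) K) ≃ₗ[MvPolynomial (Fin n) K]
      (Fin s → MvPolynomial (Fin n) K)} (h : IsGradedMap δ ε e.toLinearMap) :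
    IsGradedMap ε δ e.symm.toLinearMap := by
  intro t w hw
  have h1 := h.apply_freeComp t (e.symm w)
  simp only [LinearEquiv.coe_coe, LinearEquiv.apply_symm_apply, freeComp_of_mem hw] at h1
  rw [LinearEquiv.coe_coe, ← h1, LinearEquiv.symm_apply_apply]
  exact freeComp_mem _ _ _

/-- A graded endomorphism of a graded free module of finite rank with image in `𝔪 F` is
nilpotent: each application strictly lowers the shift of the basis elements involved. -/
theorem IsGradedMap.isNilpotent {N : Module.End (MvPolynomial (Fin n) K)
      (Fin r → MvPolynomial (Fin n) K)}
    (h : IsGradedMap δ δ N) (hm : ∀ v k, N v k ∈ irrelevant K n) : IsNilpotent N := by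
  have key : ∀ (q : ℕ) (k l : Fin r), (N ^ q) (Pi.single k 1) l ≠ 0 → (q : ℤ) ≤ δ k - δ l := by
    intro q
    induction q with
    | zero =>
      intro k l hkl
      rcases eq_or_ne l k with rfl | hne
      · simp
      · exact absurd (Pi.single_eq_of_ne hne _) hkl
    | succ q ih =>
      intro k l hkl
      rw [pow_succ, Module.End.mul_apply, apply_eq_sum_single, Finset.sum_apply] at hkl
      obtain ⟨m, -, hne⟩ := Finset.exists_ne_zero_of_sum_ne_zero hkl
      rw [Pi.smul_apply, smul_eq_mul] at hne
      have h1 := ih m l (right_ne_zero_of_mul hne)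
      have h2 : 0 < δ k - δ m := by
        by_contra! hle
        exact left_ne_zero_of_mul hne (eq_zero_of_mem_polyPiece_of_mem_irrelevant hle
          (mem_freePiece.1 (h _ _ (single_mem_freePiece δ k)) m) (hm _ _))
      push_cast
      omega
  -- the exponent exceeds all differences of shifts
  refine ⟨∑ k, ∑ l, (δ k - δ l).natAbs + 1, LinearMap.ext fun v => ?_⟩
  rw [apply_eq_sum_single, LinearMap.zero_apply]
  refine Finset.sum_eq_zero fun k _ => ?_
  suffices h0 : (N ^ (∑ k, ∑ l, (δ k - δ l).natAbs + 1)) (Pi.single k 1) = 0 by rw [h0, smul_zero]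
  funext l
  by_contra hne
  have h1 := key _ k l hne
  have h2 : (δ k - δ l).natAbs ≤ ∑ k, ∑ l, (δ k - δ l).natAbs :=
    (Finset.single_le_sum (f := fun l => (δ k - δ l).natAbs) (fun _ _ => Nat.zero_le _)
      (Finset.mem_univ l)).trans
      (Finset.single_le_sum (f := fun k => ∑ l, (δ k - δ l).natAbs) (fun _ _ => Nat.zero_le _)
        (Finset.mem_univ k))
  omega

/-! ### Uniqueness of minimal graded free covers and resolutions -/

/-- Graded isomorphic free modules `⨁_k S(-δ_k)` and `⨁_l S(-ε_l)` have equally many summands in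
each degree: modulo `𝔪`, a graded isomorphism and its inverse become mutually inverse block
diagonal matrices over `K`. -/
theorem card_shift_eq_of_gradedEquiv {e : (Fin r → MvPolynomial (Fin n) K)
      ≃ₗ[MvPolynomial (Fin n) K] (Fin s → MvPolynomial (Fin n) K)}
    (h : IsGradedMap δ ε e.toLinearMap) (j : ℤ) :
    (Finset.univ.filter fun k => δ k = j).card = (Finset.univ.filter fun l => ε l = j).card := by
  let A : Matrix (Fin s) (Fin r) K := (LinearMap.toMatrix' e.toLinearMap).map constantCoeff
  let B : Matrix (Fin r) (Fin s) K := (LinearMap.toMatrix' e.symm.toLinearMap).map constantCoeff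
  have hAB : A * B = 1 := by
    rw [← Matrix.map_mul, ← LinearMap.toMatrix'_comp]
    simp [LinearMap.toMatrix'_id]
  have hBA : B * A = 1 := by
    rw [← Matrix.map_mul, ← LinearMap.toMatrix'_comp]
    simp [LinearMap.toMatrix'_id]
  have hA : ∀ l k, ε l ≠ δ k → A l k = 0 := fun l k hne => by
    have h1 := mem_freePiece.1 (h _ _ (single_mem_freePiece δ k)) l
    have := constantCoeff_eq_zero_of_mem_polyPiece (by omega) h1
    simpa [A, LinearMap.toMatrix'_apply] using this
  have hB : ∀ k l, δ k ≠ ε l → B k l = 0 := fun k l hne => by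
    have h1 := mem_freePiece.1 (h.symm _ _ (single_mem_freePiece ε l)) k
    have := constantCoeff_eq_zero_of_mem_polyPiece (by omega) h1
    simpa [B, LinearMap.toMatrix'_apply] using this
  have h1 : A.toBlock (fun l => ε l = j) (fun k => δ k = j) *
      B.toBlock (fun k => δ k = j) (fun l => ε l = j) = 1 := by
    have := Matrix.toBlock_mul_eq_add (fun l => ε l = j) (fun k => δ k = j) (fun l => ε l = j) A B
    rw [hAB, Matrix.toBlock_one_self] at this
    rw [this, left_eq_add]
    convert Matrix.zero_mul _
    ext ⟨l, hl⟩ ⟨k, hk⟩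
    exact hA l k fun h => hk (h ▸ hl)
  have h2 : B.toBlock (fun k => δ k = j) (fun l => ε l = j) *
      A.toBlock (fun l => ε l = j) (fun k => δ k = j) = 1 := by
    have := Matrix.toBlock_mul_eq_add (fun k => δ k = j) (fun l => ε l = j) (fun k => δ k = j) B A
    rw [hBA, Matrix.toBlock_one_self] at this
    rw [this, left_eq_add]
    convert Matrix.zero_mul _
    ext ⟨l, hl⟩ ⟨k, hk⟩
    exact hB l k fun h => hk (h ▸ hl)
  have h3 := Matrix.square_of_invertible _ _ h1 h2
  rw [Fintype.card_subtype, Fintype.card_subtype] at h3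
  exact h3.symm

section Lift

variable {M : Type*} [AddCommGroup M] [Module (MvPolynomial (Fin n) K) M]

/-- Homogeneous elements of the source of `a` can be matched by homogeneous elements of the same
degree in the source of `b`. -/
def LiftsHomogeneous (δ : Fin r → ℤ) (ε : Fin s → ℤ)
    (a : (Fin r → MvPolynomial (Fin n) K) →ₗ[MvPolynomial (Fin n) K] M)
    (b : (Fin s → MvPolynomial (Fin n) K) →ₗ[MvPolynomial (Fin n) K] M) : Prop :=
  ∀ t, ∀ v ∈ freePiece K n δ t, ∃ w ∈ freePiece K n ε t, b w = a v

variable {a : (Fin r → MvPolynomial (Fin n) K) →ₗ[MvPolynomial (Fin n) K] M}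
  {b : (Fin s → MvPolynomial (Fin n) K) →ₗ[MvPolynomial (Fin n) K] M}

theorem LiftsHomogeneous.exists_map (h : LiftsHomogeneous δ ε a b) :
    ∃ φ : (Fin r → MvPolynomial (Fin n) K) →ₗ[MvPolynomial (Fin n) K]
      (Fin s → MvPolynomial (Fin n) K), IsGradedMap δ ε φ ∧ b ∘ₗ φ = a := by
  choose w hw hb using fun k => h _ _ (single_mem_freePiece δ k)
  refine ⟨(Pi.basisFun (MvPolynomial (Fin n) K) (Fin r)).constr ℕ w,
    IsGradedMap.of_single fun k => ?_, ?_⟩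
  · rw [← Pi.basisFun_apply, Module.Basis.constr_basis]
    exact hw k
  · refine (Pi.basisFun (MvPolynomial (Fin n) K) (Fin r)).ext fun k => ?_
    rw [LinearMap.comp_apply, Module.Basis.constr_basis, Pi.basisFun_apply, hb]

/-- A graded endomorphism of a minimal cover over the identity is bijective. -/
theorem IsGradedMap.isUnit_of_comp_eq {f : Module.End (MvPolynomial (Fin n) K)
      (Fin r → MvPolynomial (Fin n) K)} (hf : IsGradedMap δ δ f) (haf : a ∘ₗ f = a)
    (hm : ∀ v, a v = 0 → ∀ k, v k ∈ irrelevant K n) : IsUnit f := by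
  have h1 : IsGradedMap δ δ (f - 1) := fun t v hv => Submodule.sub_mem _ (hf t v hv) hv
  have h2 : IsNilpotent (f - 1) := h1.isNilpotent fun v => hm _ <| by
    rw [LinearMap.sub_apply, map_sub, ← LinearMap.comp_apply, haf, Module.End.one_apply, sub_self]
  simpa using h2.isUnit_one_add

/-- Two minimal graded free covers of the same module are isomorphic. -/
theorem exists_gradedEquiv_of_minimal (hab : LiftsHomogeneous δ ε a b)
    (hba : LiftsHomogeneous ε δ b a) (ha : ∀ v, a v = 0 → ∀ k, v k ∈ irrelevant K n)
    (hb : ∀ v, b v = 0 → ∀ k, v k ∈ irrelevant K n) :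
    ∃ e : (Fin r → MvPolynomial (Fin n) K) ≃ₗ[MvPolynomial (Fin n) K]
      (Fin s → MvPolynomial (Fin n) K), IsGradedMap δ ε e.toLinearMap ∧ ∀ v, b (e v) = a v := by
  obtain ⟨φ, hφ, hbφ⟩ := hab.exists_map
  obtain ⟨ψ, hψ, haψ⟩ := hba.exists_map
  have h1 : IsUnit (ψ ∘ₗ φ : Module.End _ _) := (hψ.comp hφ).isUnit_of_comp_eq
    (by rw [← LinearMap.comp_assoc, haψ, hbφ]) ha
  have h2 : IsUnit (φ ∘ₗ ψ : Module.End _ _) := (hφ.comp hψ).isUnit_of_comp_eq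
    (by rw [← LinearMap.comp_assoc, hbφ, haψ]) hb
  rw [Module.End.isUnit_iff] at h1 h2
  have hbij : Function.Bijective φ :=
    ⟨Function.Injective.of_comp (f := ψ) h1.1, Function.Surjective.of_comp (g := ψ) h2.2⟩
  exact ⟨LinearEquiv.ofBijective φ hbij, hφ, fun v => LinearMap.congr_fun hbφ v⟩

end Lift

theorem quotPiece_mem_iff {I : Ideal (MvPolynomial (Fin n) K)} {t : ℤ}
    {y : MvPolynomial (Fin n) K ⧸ I} :
    y ∈ quotPiece I t ↔ ∃ p ∈ polyPiece K n t, Ideal.Quotient.mk I p = y := Iff.rfl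

/-- `I` is closed under taking homogeneous components. -/
def IsGradedIdeal (I : Ideal (MvPolynomial (Fin n) K)) : Prop :=
  ∀ t : ℤ, ∀ p ∈ I, polyComp t p ∈ I

/-- A surjection `⨁_l S(-ε_l) ⟶ S/I` that preserves degrees is surjective in each degree. -/
theorem exists_mem_freePiece_of_mem_quotPiece {I : Ideal (MvPolynomial (Fin n) K)}
    (hI : IsGradedIdeal I)
    {b : (Fin s → MvPolynomial (Fin n) K) →ₗ[MvPolynomial (Fin n) K] (MvPolynomial (Fin n) K ⧸ I)}
    (hb : ∀ t, ∀ v ∈ freePiece K n ε t, b v ∈ quotPiece I t) (hs : Function.Surjective b)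
    {t : ℤ} {y : MvPolynomial (Fin n) K ⧸ I} (hy : y ∈ quotPiece I t) :
    ∃ w ∈ freePiece K n ε t, b w = y := by
  -- `b` lifts to the graded map `w ↦ ∑ l, w l * g l` into `S`, so the degree `t` part of any
  -- preimage of `y` is a preimage as well
  choose g hg hgb using fun l => quotPiece_mem_iff.1 (hb _ _ (single_mem_freePiece ε l))
  have hmk : ∀ w, b w = Ideal.Quotient.mk I (∑ l, w l * g l) := fun w => by
    rw [apply_eq_sum_single, map_sum]
    refine Finset.sum_congr rfl fun l _ => ?_
    rw [← hgb l, map_mul]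
    rfl
  obtain ⟨p, hp, rfl⟩ := quotPiece_mem_iff.1 hy
  obtain ⟨w, hw⟩ := hs (Ideal.Quotient.mk I p)
  refine ⟨freeComp ε t w, freeComp_mem _ _ _, ?_⟩
  rw [hmk] at hw ⊢
  rw [Ideal.Quotient.eq] at hw ⊢
  have := hI t _ hw
  rw [map_sub, map_sum, polyComp_of_mem hp] at this
  simpa only [polyComp_mul_right (hg _), freeComp] using this

namespace MinimalGradedResolution

variable {I : Ideal (MvPolynomial (Fin n) K)} (F G : MinimalGradedResolution I)

theorem isGradedMap_d (i : ℕ) : IsGradedMap (F.shift (i + 1)) (F.shift i) (F.d i) := F.d_graded i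

theorem mem_irrelevant_of_d_eq_zero (i : ℕ) (v : Fin (F.rank (i + 1)) → MvPolynomial (Fin n) K)
    (hv : F.d i v = 0) (k : Fin (F.rank (i + 1))) : v k ∈ irrelevant K n := by
  obtain ⟨w, rfl⟩ := (F.exact_d i v).1 hv
  exact F.minimal (i + 1) w k

theorem mem_irrelevant_of_aug_eq_zero (v : Fin (F.rank 0) → MvPolynomial (Fin n) K)
    (hv : F.aug v = 0) (k : Fin (F.rank 0)) : v k ∈ irrelevant K n := by
  obtain ⟨w, rfl⟩ := (F.exact_aug v).1 hv
  exact F.minimal 0 w k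

variable {F G}

theorem liftsHomogeneous_d {i : ℕ} {e : (Fin (F.rank i) → MvPolynomial (Fin n) K)
      ≃ₗ[MvPolynomial (Fin n) K] (Fin (G.rank i) → MvPolynomial (Fin n) K)}
    (he : IsGradedMap (F.shift i) (G.shift i) e.toLinearMap)
    (hr : ∀ v, v ∈ LinearMap.range (F.d i) → e v ∈ LinearMap.range (G.d i)) :
    LiftsHomogeneous (F.shift (i + 1)) (G.shift (i + 1)) (e.toLinearMap ∘ₗ F.d i) (G.d i) := by
  intro t v hv
  obtain ⟨w, hw⟩ := hr _ ⟨v, rfl⟩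
  refine ⟨freeComp _ t w, freeComp_mem _ _ _, ?_⟩
  rw [(G.isGradedMap_d i).apply_freeComp, hw]
  exact freeComp_of_mem (he t _ (F.d_graded i t v hv))

/-- Extends an isomorphism in homological degree `i` that matches the images of the differentials:
by exactness both `F_{i+1}` and `G_{i+1}` are minimal covers of that image. -/
theorem exists_gradedEquiv_succ {i : ℕ} {e : (Fin (F.rank i) → MvPolynomial (Fin n) K)
      ≃ₗ[MvPolynomial (Fin n) K] (Fin (G.rank i) → MvPolynomial (Fin n) K)}
    (he : IsGradedMap (F.shift i) (G.shift i) e.toLinearMap)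
    (hr : ∀ v, v ∈ LinearMap.range (F.d i) ↔ e v ∈ LinearMap.range (G.d i)) :
    ∃ e' : (Fin (F.rank (i + 1)) → MvPolynomial (Fin n) K)
      ≃ₗ[MvPolynomial (Fin n) K] (Fin (G.rank (i + 1)) → MvPolynomial (Fin n) K),
      IsGradedMap (F.shift (i + 1)) (G.shift (i + 1)) e'.toLinearMap ∧
      ∀ v, v ∈ LinearMap.range (F.d (i + 1)) ↔ e' v ∈ LinearMap.range (G.d (i + 1)) := by
  have h1 := liftsHomogeneous_d he fun v => (hr v).1
  have h2 : LiftsHomogeneous (G.shift (i + 1)) (F.shift (i + 1)) (G.d i)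
      (e.toLinearMap ∘ₗ F.d i) := by
    intro t w hw
    obtain ⟨v, hv, hve⟩ := liftsHomogeneous_d he.symm
      (fun v hv => (hr _).2 (by simpa using hv)) t w hw
    exact ⟨v, hv, by simp [hve]⟩
  obtain ⟨e', he', hcomm⟩ := exists_gradedEquiv_of_minimal h1 h2
    (fun v hv => F.mem_irrelevant_of_d_eq_zero i v (e.map_eq_zero_iff.1 hv))
    (G.mem_irrelevant_of_d_eq_zero i)
  refine ⟨e', he', fun v => ?_⟩
  rw [LinearMap.mem_range, LinearMap.mem_range]
  rw [← Set.mem_range, ← Set.mem_range, ← F.exact_d i, ← G.exact_d i, hcomm]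
  exact (e.map_eq_zero_iff (x := F.d i v)).symm

/-- Two minimal graded free resolutions of `S/I` are termwise isomorphic. Matching the images of
the next differentials is what the induction carries along. -/
theorem exists_gradedEquiv (hI : IsGradedIdeal I) (F G : MinimalGradedResolution I) (i : ℕ) :
    ∃ e : (Fin (F.rank i) → MvPolynomial (Fin n) K)
      ≃ₗ[MvPolynomial (Fin n) K] (Fin (G.rank i) → MvPolynomial (Fin n) K),
      IsGradedMap (F.shift i) (G.shift i) e.toLinearMap ∧
      ∀ v, v ∈ LinearMap.range (F.d i) ↔ e v ∈ LinearMap.range (G.d i) := by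
  induction i with
  | zero =>
    obtain ⟨e, he, hcomm⟩ := exists_gradedEquiv_of_minimal (a := F.aug) (b := G.aug)
      (fun t v hv => exists_mem_freePiece_of_mem_quotPiece hI G.aug_graded G.aug_surjective
        (F.aug_graded t v hv))
      (fun t v hv => exists_mem_freePiece_of_mem_quotPiece hI F.aug_graded F.aug_surjective
        (G.aug_graded t v hv))
      F.mem_irrelevant_of_aug_eq_zero G.mem_irrelevant_of_aug_eq_zero
    refine ⟨e, he, fun v => ?_⟩
    rw [LinearMap.mem_range, LinearMap.mem_range]
    rw [← Set.mem_range, ← Set.mem_range, ← F.exact_aug, ← G.exact_aug, hcomm]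
  | succ i ih =>
    obtain ⟨e, he, hr⟩ := ih
    exact exists_gradedEquiv_succ he hr

theorem rank_eq (hI : IsGradedIdeal I) (F G : MinimalGradedResolution I) (i : ℕ) :
    F.rank i = G.rank i := by
  obtain ⟨e, -⟩ := exists_gradedEquiv hI F G i
  simpa using e.finrank_eq

theorem betti_eq (hI : IsGradedIdeal I) (F G : MinimalGradedResolution I) (i : ℕ) (j : ℤ) :
    F.betti i j = G.betti i j := by
  obtain ⟨e, he, -⟩ := exists_gradedEquiv hI F G i
  exact card_shift_eq_of_gradedEquiv he j

end MinimalGradedResolution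

/-! ### Graded complete intersections -/

/-- `IsGradedCI J ds`: the ideal `J` is obtained from `0` by successively adding homogeneous
elements of positive degrees that are non-zero-divisors modulo the previous ones; `ds` lists their
degrees, the last one first. -/
inductive IsGradedCI : Ideal (MvPolynomial (Fin n) K) → List ℕ → Prop
  | bot : IsGradedCI ⊥ []
  | sup {J : Ideal (MvPolynomial (Fin n) K)} {ds : List ℕ} {f : MvPolynomial (Fin n) K} {d : ℕ} :
    IsGradedCI J ds → f.IsHomogeneous d → 0 < d → (∀ p, f * p ∈ J → p ∈ J) →
    IsGradedCI (J ⊔ Ideal.span {f}) (d :: ds)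

theorem mem_sup_span_singleton {J : Ideal (MvPolynomial (Fin n) K)} {f p : MvPolynomial (Fin n) K} :
    p ∈ J ⊔ Ideal.span {f} ↔ ∃ q, p - q * f ∈ J := by
  constructor
  · intro h
    obtain ⟨a, ha, b, hb, rfl⟩ := Submodule.mem_sup.1 h
    obtain ⟨q, rfl⟩ := Ideal.mem_span_singleton'.1 hb
    exact ⟨q, by simpa using ha⟩
  · rintro ⟨q, hq⟩
    exact Submodule.mem_sup.2 ⟨_, hq, q * f, Ideal.mem_span_singleton'.2 ⟨q, rfl⟩, by ring⟩

theorem IsGradedIdeal.sup {J : Ideal (MvPolynomial (Fin n) K)} (hJ : IsGradedIdeal J)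
    {f : MvPolynomial (Fin n) K} {d : ℕ} (hf : f.IsHomogeneous d) :
    IsGradedIdeal (J ⊔ Ideal.span {f}) := by
  intro t p hp
  obtain ⟨q, hq⟩ := mem_sup_span_singleton.1 hp
  refine mem_sup_span_singleton.2 ⟨polyComp (t - d) q, ?_⟩
  rw [← polyComp_mul_right (mem_polyPiece_natCast.2 hf), ← map_sub]
  exact hJ t _ hq

theorem IsGradedCI.isGradedIdeal {J : Ideal (MvPolynomial (Fin n) K)} {ds : List ℕ}
    (h : IsGradedCI J ds) : IsGradedIdeal J := by
  induction h with
  | bot => exact fun t p hp => by rw [(Submodule.mem_bot _).1 hp, map_zero]; exact zero_mem _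
  | sup _ hf _ _ ih => exact ih.sup hf

/-- `koszulBetti ds i j`: the number of summands `S(-j)` in homological degree `i` of the Koszul
complex on forms of degrees `ds`. -/
def koszulBetti : List ℕ → ℕ → ℤ → ℕ
  | [], 0, j => if j = 0 then 1 else 0
  | [], _ + 1, _ => 0
  | _ :: ds, 0, j => koszulBetti ds 0 j
  | d :: ds, i + 1, j => koszulBetti ds (i + 1) j + koszulBetti ds i (j - d)

theorem koszulBetti_perm {l₁ l₂ : List ℕ} (h : l₁.Perm l₂) (i : ℕ) (j : ℤ) :
    koszulBetti l₁ i j = koszulBetti l₂ i j := by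
  induction h generalizing i j with
  | nil => rfl
  | cons a _ ih => cases i <;> simp [koszulBetti, ih]
  | swap a b l =>
    rcases i with _ | _ | i
    · rfl
    · simp only [koszulBetti]; ring
    · simp only [koszulBetti, sub_right_comm j (b : ℤ) (a : ℤ)]; ring
  | trans _ _ ih₁ ih₂ => rw [ih₁, ih₂]

/-! ### Mapping cones -/

/-- Splitting a free module of rank `a + b`. -/
noncomputable def finAddEquiv (R : Type*) [CommRing R] (a b : ℕ) :
    (Fin (a + b) → R) ≃ₗ[R] (Fin a → R) × (Fin b → R) :=
  (LinearEquiv.funCongrLeft R R finSumFinEquiv).trans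
    (LinearEquiv.sumArrowLequivProdArrow (Fin a) (Fin b) R R)

theorem finAddEquiv_fst {R : Type*} [CommRing R] {a b : ℕ} (v : Fin (a + b) → R) (k : Fin a) :
    (finAddEquiv R a b v).1 k = v (Fin.castAdd b k) := rfl

theorem finAddEquiv_snd {R : Type*} [CommRing R] {a b : ℕ} (v : Fin (a + b) → R) (k : Fin b) :
    (finAddEquiv R a b v).2 k = v (Fin.natAdd a k) := rfl

theorem mem_freePiece_append {a b : ℕ} {δ : Fin a → ℤ} {ε : Fin b → ℤ} {t : ℤ}
    {v : Fin (a + b) → MvPolynomial (Fin n) K} :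
    v ∈ freePiece K n (Fin.append δ ε) t ↔
      (finAddEquiv _ a b v).1 ∈ freePiece K n δ t ∧ (finAddEquiv _ a b v).2 ∈ freePiece K n ε t := by
  simp only [mem_freePiece, finAddEquiv_fst, finAddEquiv_snd]
  constructor
  · intro h
    exact ⟨fun k => by simpa using h (Fin.castAdd b k), fun k => by simpa using h (Fin.natAdd a k)⟩
  · rintro ⟨h1, h2⟩ k
    induction k using Fin.addCases with
    | left k => simpa using h1 k
    | right k => simpa using h2 k

theorem smul_mem_freePiece {r : ℕ} {δ : Fin r → ℤ} {t : ℤ} {d : ℕ}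
    {f : MvPolynomial (Fin n) K} (hf : f.IsHomogeneous d) {v : Fin r → MvPolynomial (Fin n) K}
    (hv : v ∈ freePiece K n (fun k => δ k + d) t) : f • v ∈ freePiece K n δ t := by
  rw [mem_freePiece] at hv ⊢
  intro k
  have := mul_mem_polyPiece (mem_polyPiece_natCast.2 hf) (hv k)
  rwa [show (d : ℤ) + (t - (δ k + d)) = t - δ k by ring] at this

theorem freePiece_shift {r : ℕ} {δ : Fin r → ℤ} {t : ℤ} {d : ℕ}
    {v : Fin r → MvPolynomial (Fin n) K} :
    v ∈ freePiece K n (fun k => δ k + d) t ↔ v ∈ freePiece K n δ (t - d) := by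
  simp only [mem_freePiece, sub_add_eq_sub_sub_swap]

theorem card_append_eq {a b : ℕ} (δ : Fin a → ℤ) (ε : Fin b → ℤ) (j : ℤ) :
    (Finset.univ.filter fun k => Fin.append δ ε k = j).card =
      (Finset.univ.filter fun k => δ k = j).card + (Finset.univ.filter fun k => ε k = j).card := by
  simp only [Finset.card_filter, Fin.sum_univ_add, Fin.append_left, Fin.append_right]

namespace MinimalGradedResolution

variable {J : Ideal (MvPolynomial (Fin n) K)}

/-- The minimal resolution of `S/0` is `S` itself. -/
noncomputable def ofBot (K : Type*) [Field K] (n : ℕ) :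
    MinimalGradedResolution (⊥ : Ideal (MvPolynomial (Fin n) K)) where
  rank i := match i with
    | 0 => 1
    | _ + 1 => 0
  shift _ _ := 0
  d _ := 0
  aug := (Submodule.mkQ ⊥) ∘ₗ LinearMap.proj (0 : Fin 1)
  rank_eventually_zero := ⟨0, fun i hi => by cases i <;> simp_all⟩
  d_graded _ _ _ _ := Submodule.zero_mem _
  aug_graded t v hv := ⟨v (0 : Fin 1), by simpa using mem_freePiece.1 hv (0 : Fin 1), rfl⟩
  aug_surjective := (Submodule.mkQ_surjective _).comp
    (LinearMap.proj_surjective (R := MvPolynomial (Fin n) K)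
      (φ := fun _ : Fin 1 => MvPolynomial (Fin n) K) (0 : Fin 1))
  exact_aug v := by
    constructor
    · intro h
      refine ⟨0, ?_⟩
      have h0 : v (0 : Fin 1) = 0 := (Submodule.mem_bot _).1 ((Submodule.Quotient.mk_eq_zero _).1 h)
      funext k
      rw [Subsingleton.elim k (0 : Fin 1), h0]
      rfl
    · rintro ⟨w, rfl⟩
      exact map_zero _
  exact_d i v := ⟨fun _ => ⟨0, Subsingleton.elim (α := Fin 0 → MvPolynomial (Fin n) K) _ _⟩,
    fun _ => rfl⟩
  minimal _ _ _ := Submodule.zero_mem _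

theorem betti_ofBot (i : ℕ) (j : ℤ) : (ofBot K n).betti i j = koszulBetti [] i j := by
  cases i with
  | zero =>
    change (Finset.univ.filter fun _ : Fin 1 => (0 : ℤ) = j).card = if j = 0 then 1 else 0
    rcases eq_or_ne j 0 with rfl | h
    · simp
    · simp [h, h.symm]
  | succ i =>
    change (Finset.univ.filter fun _ : Fin 0 => (0 : ℤ) = j).card = 0
    simp

section Cone

variable (F : MinimalGradedResolution J)

/-- The ranks of the mapping cone of `f : F(-d) ⟶ F`. -/
abbrev coneRank : ℕ → ℕ
  | 0 => F.rank 0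
  | i + 1 => F.rank (i + 1) + F.rank i

/-- The shifts of the mapping cone of `f : F(-d) ⟶ F`. -/
def coneShift (d : ℕ) : ∀ i, Fin (F.coneRank i) → ℤ
  | 0 => F.shift 0
  | i + 1 => Fin.append (F.shift (i + 1)) fun k => F.shift i k + d

/-- The differential of the mapping cone of `f : F(-d) ⟶ F`: it is `(a, b) ↦ d a + f b` in degree
one and `(a, b) ↦ (d a + f b, -d b)` above. -/
noncomputable def coneD (f : MvPolynomial (Fin n) K) :
    ∀ i, (Fin (F.coneRank (i + 1)) → MvPolynomial (Fin n) K) →ₗ[MvPolynomial (Fin n) K]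
      (Fin (F.coneRank i) → MvPolynomial (Fin n) K)
  | 0 => (F.d 0).coprod (f • LinearMap.id) ∘ₗ (finAddEquiv _ (F.rank 1) (F.rank 0)).toLinearMap
  | i + 1 => (finAddEquiv _ (F.rank (i + 1)) (F.rank i)).symm.toLinearMap ∘ₗ
      ((F.d (i + 1)).coprod (f • LinearMap.id)).prod (-(F.d i) ∘ₗ LinearMap.snd _ _ _) ∘ₗ
      (finAddEquiv _ (F.rank (i + 2)) (F.rank (i + 1))).toLinearMap

/-- The augmentation of the mapping cone of `f : F(-d) ⟶ F`. -/
noncomputable def coneAug (f : MvPolynomial (Fin n) K) :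
    (Fin (F.coneRank 0) → MvPolynomial (Fin n) K) →ₗ[MvPolynomial (Fin n) K]
      (MvPolynomial (Fin n) K ⧸ (J ⊔ Ideal.span {f})) :=
  (Ideal.Quotient.factorₐ (MvPolynomial (Fin n) K)
    (le_sup_left : J ≤ J ⊔ Ideal.span {f})).toLinearMap ∘ₗ F.aug

variable {F}

theorem coneD_zero_apply (f : MvPolynomial (Fin n) K)
    (v : Fin (F.rank 1 + F.rank 0) → MvPolynomial (Fin n) K) :
    F.coneD f 0 v = F.d 0 (finAddEquiv _ _ _ v).1 + f • (finAddEquiv _ _ _ v).2 := rfl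

theorem coneD_succ_apply (f : MvPolynomial (Fin n) K) (i : ℕ)
    (v : Fin (F.rank (i + 2) + F.rank (i + 1)) → MvPolynomial (Fin n) K) :
    finAddEquiv _ (F.rank (i + 1)) (F.rank i) (F.coneD f (i + 1) v) =
      (F.d (i + 1) (finAddEquiv _ _ _ v).1 + f • (finAddEquiv _ _ _ v).2,
        - F.d i (finAddEquiv _ _ _ v).2) :=
  (finAddEquiv _ (F.rank (i + 1)) (F.rank i)).apply_symm_apply _

/-- An element is killed by the augmentation of the cone iff its image in `S/J` is a multiple of
`f`. -/
theorem coneAug_eq_zero_iff (f : MvPolynomial (Fin n) K)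
    (v : Fin (F.rank 0) → MvPolynomial (Fin n) K) :
    F.coneAug f v = 0 ↔ ∃ w, F.aug (v - f • w) = 0 := by
  obtain ⟨p, hp⟩ := Ideal.Quotient.mk_surjective (F.aug v)
  have h1 : F.coneAug f v = Ideal.Quotient.mk (J ⊔ Ideal.span {f}) p := by
    change Ideal.Quotient.factor le_sup_left (F.aug v) = _
    rw [← hp, Ideal.Quotient.factor_mk]
  rw [h1, Ideal.Quotient.eq_zero_iff_mem, mem_sup_span_singleton]
  constructor
  · rintro ⟨q, hq⟩
    obtain ⟨w, hw⟩ := F.aug_surjective (Ideal.Quotient.mk J q)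
    refine ⟨w, ?_⟩
    rw [map_sub, map_smul, hw, ← hp]
    rw [← Ideal.Quotient.eq_zero_iff_mem, mul_comm] at hq
    exact hq
  · rintro ⟨w, hw⟩
    obtain ⟨q, hq⟩ := Ideal.Quotient.mk_surjective (F.aug w)
    refine ⟨q, ?_⟩
    rw [map_sub, map_smul, ← hq, ← hp] at hw
    rw [← Ideal.Quotient.eq_zero_iff_mem, mul_comm]
    exact hw

theorem exists_eq_d_of_add_smul_eq_zero {i : ℕ} {f : MvPolynomial (Fin n) K}
    {a : Fin (F.rank (i + 1)) → MvPolynomial (Fin n) K}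
    {c : Fin (F.rank (i + 1)) → MvPolynomial (Fin n) K}
    (h : F.d i a + f • F.d i c = 0) : ∃ e, a = F.d (i + 1) e - f • c := by
  rw [← map_smul, ← map_add] at h
  obtain ⟨e, he⟩ := (F.exact_d i _).1 h
  exact ⟨e, eq_sub_of_add_eq he.symm⟩

/-- If `f` is a form of positive degree that is a non-zero-divisor modulo `J`, the mapping cone of
`f : F(-d) ⟶ F` is a minimal resolution of `S/(J + (f))`. -/
noncomputable def cone (F : MinimalGradedResolution J) {f : MvPolynomial (Fin n) K} {d : ℕ}
    (hf : f.IsHomogeneous d) (hd : 0 < d) (hreg : ∀ p, f * p ∈ J → p ∈ J) :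
    MinimalGradedResolution (J ⊔ Ideal.span {f}) where
  rank := F.coneRank
  shift := F.coneShift d
  d := F.coneD f
  aug := F.coneAug f
  rank_eventually_zero := by
    obtain ⟨N, hN⟩ := F.rank_eventually_zero
    refine ⟨N + 1, fun i hi => ?_⟩
    cases i with
    | zero => omega
    | succ i => rw [coneRank, hN _ (by omega), hN _ (by omega)]
  d_graded i t v hv := by
    obtain ⟨h1, h2⟩ := mem_freePiece_append.1 hv
    cases i with
    | zero => exact Submodule.add_mem _ (F.d_graded 0 t _ h1) (smul_mem_freePiece hf h2)
    | succ i =>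
      refine mem_freePiece_append.2 ?_
      rw [coneD_succ_apply]
      refine ⟨Submodule.add_mem _ (F.d_graded _ t _ h1) (smul_mem_freePiece hf h2),
        Submodule.neg_mem _ ?_⟩
      rw [freePiece_shift] at h2 ⊢
      exact F.d_graded _ _ _ h2
  aug_graded t v hv := by
    obtain ⟨p, hp, hpv⟩ := quotPiece_mem_iff.1 (F.aug_graded t v hv)
    refine quotPiece_mem_iff.2 ⟨p, hp, ?_⟩
    change _ = Ideal.Quotient.factor le_sup_left (F.aug v)
    rw [← hpv, Ideal.Quotient.factor_mk]
  aug_surjective := (Ideal.Quotient.factor_surjective le_sup_left).comp F.aug_surjective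
  exact_aug v := by
    rw [coneAug_eq_zero_iff]
    constructor
    · rintro ⟨w, hw⟩
      obtain ⟨u, hu⟩ := (F.exact_aug _).1 hw
      refine ⟨(finAddEquiv _ _ _).symm (u, w), ?_⟩
      rw [coneD_zero_apply, LinearEquiv.apply_symm_apply, hu]
      exact sub_add_cancel _ _
    · rintro ⟨u, rfl⟩
      refine ⟨(finAddEquiv _ _ _ u).2, ?_⟩
      rw [coneD_zero_apply, add_sub_cancel_right]
      exact (F.exact_aug _).2 ⟨_, rfl⟩
  exact_d i v := by
    cases i with
    | zero =>
      rw [coneD_zero_apply]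
      constructor
      · intro h
        have hb : F.aug (finAddEquiv _ (F.rank 1) (F.rank 0) v).2 = 0 := by
          have h0 := congrArg F.aug h
          rw [map_add, map_zero, (F.exact_aug _).2 ⟨_, rfl⟩, zero_add, map_smul] at h0
          -- `f` is a non-zero-divisor on `S/J`
          obtain ⟨p, hp⟩ := Ideal.Quotient.mk_surjective
            (F.aug (finAddEquiv _ (F.rank 1) (F.rank 0) v).2)
          rw [← hp] at h0 ⊢
          exact Ideal.Quotient.eq_zero_iff_mem.2 (hreg p (Ideal.Quotient.eq_zero_iff_mem.1 h0))
        obtain ⟨c, hc⟩ := (F.exact_aug _).1 hb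
        rw [← hc] at h
        obtain ⟨e, he⟩ := exists_eq_d_of_add_smul_eq_zero h
        refine ⟨(finAddEquiv _ (F.rank 2) (F.rank 1)).symm (e, -c), ?_⟩
        apply (finAddEquiv _ (F.rank 1) (F.rank 0)).injective
        rw [coneD_succ_apply, LinearEquiv.apply_symm_apply]
        refine Prod.ext ?_ ?_
        · rw [he, smul_neg, sub_eq_add_neg]
        · rw [map_neg, neg_neg, hc]
      · rintro ⟨u, rfl⟩
        rw [coneD_succ_apply, map_add, map_smul, smul_neg, (F.exact_d 0 _).2 ⟨_, rfl⟩]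
        simp
    | succ i =>
      constructor
      · intro h
        have h0 := congrArg (finAddEquiv _ (F.rank (i + 1)) (F.rank i)) h
        rw [coneD_succ_apply, map_zero] at h0
        obtain ⟨h, hb⟩ := Prod.ext_iff.1 h0
        obtain ⟨c, hc⟩ := (F.exact_d i _).1 (neg_eq_zero.1 hb)
        rw [← hc] at h
        obtain ⟨e, he⟩ := exists_eq_d_of_add_smul_eq_zero h
        refine ⟨(finAddEquiv _ (F.rank (i + 3)) (F.rank (i + 2))).symm (e, -c), ?_⟩
        apply (finAddEquiv _ (F.rank (i + 2)) (F.rank (i + 1))).injective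
        rw [coneD_succ_apply, LinearEquiv.apply_symm_apply]
        refine Prod.ext ?_ ?_
        · rw [he, smul_neg, sub_eq_add_neg]
        · rw [map_neg, neg_neg, hc]
      · rintro ⟨u, rfl⟩
        apply (finAddEquiv _ (F.rank (i + 1)) (F.rank i)).injective
        rw [coneD_succ_apply, coneD_succ_apply, map_add, map_smul, smul_neg, map_neg,
          (F.exact_d (i + 1) _).2 ⟨_, rfl⟩, (F.exact_d i _).2 ⟨_, rfl⟩, map_zero]
        refine Prod.ext ?_ ?_ <;> simp
  minimal i v k := by
    have hfm : f ∈ irrelevant K n := mem_irrelevant_iff.2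
      (constantCoeff_eq_zero_of_mem_polyPiece (t := d) (by omega) hf)
    cases i with
    | zero =>
      rw [coneD_zero_apply]
      exact Ideal.add_mem _ (F.minimal 0 _ k) (Ideal.mul_mem_right _ _ hfm)
    | succ i =>
      have h := coneD_succ_apply f i v
      induction k using Fin.addCases with
      | left k =>
        have h1 := congrFun (congrArg Prod.fst h) k
        rw [finAddEquiv_fst] at h1
        refine (congrArg (· ∈ irrelevant K n) h1).mpr ?_
        exact Ideal.add_mem _ (F.minimal (i + 1) _ k) (Ideal.mul_mem_right _ _ hfm)
      | right k =>
        have h1 := congrFun (congrArg Prod.snd h) k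
        rw [finAddEquiv_snd] at h1
        refine (congrArg (· ∈ irrelevant K n) h1).mpr ?_
        exact neg_mem (F.minimal i _ k)

theorem betti_cone_succ (F : MinimalGradedResolution J) {f : MvPolynomial (Fin n) K} {d : ℕ}
    (hf : f.IsHomogeneous d) (hd : 0 < d) (hreg : ∀ p, f * p ∈ J → p ∈ J) (i : ℕ) (j : ℤ) :
    (F.cone hf hd hreg).betti (i + 1) j = F.betti (i + 1) j + F.betti i (j - d) := by
  refine (card_append_eq (F.shift (i + 1)) (fun k => F.shift i k + d) j).trans ?_
  simp only [betti, eq_sub_iff_add_eq]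

end Cone

end MinimalGradedResolution

/-- The iterated mapping cone, that is, the Koszul complex of the generators. -/
theorem IsGradedCI.exists_resolution {J : Ideal (MvPolynomial (Fin n) K)} {ds : List ℕ}
    (h : IsGradedCI J ds) : ∃ F : MinimalGradedResolution J,
      (∀ i, F.rank i = ds.length.choose i) ∧ ∀ i j, F.betti i j = koszulBetti ds i j := by
  induction h with
  | bot =>
    refine ⟨.ofBot K n, fun i => ?_, MinimalGradedResolution.betti_ofBot⟩
    cases i <;> rfl
  | sup _ hf hd hreg ih =>
    obtain ⟨F, hr, hb⟩ := ih
    refine ⟨F.cone hf hd hreg, fun i => ?_, fun i j => ?_⟩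
    · cases i with
      | zero => exact (hr 0).trans (by simp)
      | succ i =>
        refine (congrArg₂ (· + ·) (hr (i + 1)) (hr i)).trans ?_
        rw [List.length_cons, Nat.choose_succ_succ, add_comm]
    · cases i with
      | zero => exact hb 0 j
      | succ i => rw [F.betti_cone_succ, hb, hb, koszulBetti]

theorem IsGradedCI.rank_eq {J : Ideal (MvPolynomial (Fin n) K)} {ds : List ℕ}
    (h : IsGradedCI J ds) (F : MinimalGradedResolution J) (i : ℕ) :
    F.rank i = ds.length.choose i := by
  obtain ⟨G, hG, -⟩ := h.exists_resolution
  rw [MinimalGradedResolution.rank_eq h.isGradedIdeal F G, hG]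

theorem IsGradedCI.betti_eq {J : Ideal (MvPolynomial (Fin n) K)} {ds : List ℕ}
    (h : IsGradedCI J ds) (F : MinimalGradedResolution J) (i : ℕ) (j : ℤ) :
    F.betti i j = koszulBetti ds i j := by
  obtain ⟨G, -, hG⟩ := h.exists_resolution
  rw [MinimalGradedResolution.betti_eq h.isGradedIdeal F G, hG]

/-! ### Hilbert functions -/

instance finite_polyPiece (t : ℤ) : Module.Finite K (polyPiece K n t) := by
  cases t with
  | ofNat d => exact Module.Finite.iff_fg.2 (homogeneousSubmodule_fg (Fin n) K d)
  | negSucc d => exact inferInstanceAs (Module.Finite K (⊥ : Submodule K _))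

instance finite_quotPiece (I : Ideal (MvPolynomial (Fin n) K)) (t : ℤ) :
    Module.Finite K (quotPiece I t) :=
  inferInstanceAs (Module.Finite K (Submodule.map _ _))

/-- Multiplication by a form `f` of degree `d` that is a non-zero-divisor on `S/J` gives exact
sequences `0 ⟶ (S/J)_{t-d} ⟶ (S/J)_t ⟶ (S/(J + (f)))_t ⟶ 0`. -/
theorem hilbertFn_sup_add {J : Ideal (MvPolynomial (Fin n) K)} (hJ : IsGradedIdeal J)
    {f : MvPolynomial (Fin n) K} {d : ℕ} (hf : f.IsHomogeneous d)
    (hreg : ∀ p, f * p ∈ J → p ∈ J) (t : ℤ) :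
    hilbertFn (J ⊔ Ideal.span {f}) t + hilbertFn J (t - d) = hilbertFn J t := by
  have hf' : f ∈ polyPiece K n (d : ℤ) := mem_polyPiece_natCast.2 hf
  let g : (MvPolynomial (Fin n) K ⧸ J) →ₗ[K] (MvPolynomial (Fin n) K ⧸ (J ⊔ Ideal.span {f})) :=
    (Ideal.Quotient.factorₐ K (le_sup_left : J ≤ J ⊔ Ideal.span {f})).toLinearMap
  have hg : ∀ p, g (Ideal.Quotient.mk J p) = Ideal.Quotient.mk _ p := fun p => rfl
  let m : (MvPolynomial (Fin n) K ⧸ J) →ₗ[K] (MvPolynomial (Fin n) K ⧸ J) :=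
    LinearMap.mulRight K (Ideal.Quotient.mk J f)
  have hm : ∀ p, m (Ideal.Quotient.mk J p) = Ideal.Quotient.mk J (p * f) := fun p => rfl
  have hminj : Function.Injective m := by
    rw [injective_iff_map_eq_zero]
    intro y hy
    obtain ⟨p, rfl⟩ := Ideal.Quotient.mk_surjective y
    rw [hm, Ideal.Quotient.eq_zero_iff_mem, mul_comm] at hy
    exact Ideal.Quotient.eq_zero_iff_mem.2 (hreg p hy)
  have hrange : LinearMap.range (g.domRestrict (quotPiece J t)) =
      quotPiece (J ⊔ Ideal.span {f}) t := by
    rw [LinearMap.range_domRestrict, quotPiece, quotPiece, ← Submodule.map_comp]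
    rfl
  have hker : (LinearMap.ker (g.domRestrict (quotPiece J t))).map (quotPiece J t).subtype =
      (quotPiece J (t - d)).map m := by
    ext y
    simp only [Submodule.mem_map, LinearMap.mem_ker, Submodule.subtype_apply, Subtype.exists,
      LinearMap.domRestrict_apply]
    constructor
    · rintro ⟨_, hy, h0, rfl⟩
      obtain ⟨p, hp, rfl⟩ := quotPiece_mem_iff.1 hy
      rw [hg, Ideal.Quotient.eq_zero_iff_mem] at h0
      obtain ⟨q, hq⟩ := mem_sup_span_singleton.1 h0
      have h1 := hJ t _ hq
      rw [map_sub, polyComp_mul_right hf', polyComp_of_mem hp] at h1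
      exact ⟨_, quotPiece_mem_iff.2 ⟨_, polyComp_mem (t - d) q, rfl⟩,
        (Ideal.Quotient.eq.2 h1).symm⟩
    · rintro ⟨_, hy, rfl⟩
      obtain ⟨p, hp, rfl⟩ := quotPiece_mem_iff.1 hy
      refine ⟨_, quotPiece_mem_iff.2 ⟨p * f, ?_, rfl⟩, ?_, rfl⟩
      · simpa using mul_mem_polyPiece hp hf'
      · rw [hg, Ideal.Quotient.eq_zero_iff_mem]
        exact mem_sup_span_singleton.2 ⟨p, by simp⟩
  have h1 := LinearMap.finrank_range_add_finrank_ker (g.domRestrict (quotPiece J t))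
  rw [hrange] at h1
  have h2 := (Submodule.equivMapOfInjective (quotPiece J t).subtype (Submodule.injective_subtype _)
    (LinearMap.ker (g.domRestrict (quotPiece J t)))).finrank_eq
  rw [hker] at h2
  have h3 := (Submodule.equivMapOfInjective m hminj (quotPiece J (t - d))).finrank_eq
  rw [hilbertFn, hilbertFn, hilbertFn, h3, ← h2, h1]

theorem hilbertFn_neg (I : Ideal (MvPolynomial (Fin n) K)) {t : ℤ} (ht : t < 0) :
    hilbertFn I t = 0 := by
  obtain ⟨d, rfl⟩ := Int.eq_negSucc_of_lt_zero ht
  rw [hilbertFn, quotPiece, polyPiece, Submodule.map_bot, finrank_bot]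

/-- The Hilbert series `∑ H(S/I, i) X^i`. -/
noncomputable def hilbertSeries (I : Ideal (MvPolynomial (Fin n) K)) : PowerSeries ℤ :=
  PowerSeries.mk fun i => (hilbertFn I (i : ℤ) : ℤ)

theorem hilbertSeries_sup {J : Ideal (MvPolynomial (Fin n) K)} (hJ : IsGradedIdeal J)
    {f : MvPolynomial (Fin n) K} {d : ℕ} (hf : f.IsHomogeneous d)
    (hreg : ∀ p, f * p ∈ J → p ∈ J) :
    hilbertSeries (J ⊔ Ideal.span {f}) = (1 - PowerSeries.X ^ d) * hilbertSeries J := by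
  ext i
  have h := hilbertFn_sup_add hJ hf hreg i
  rw [sub_mul, one_mul, map_sub, PowerSeries.coeff_X_pow_mul', hilbertSeries, hilbertSeries,
    PowerSeries.coeff_mk, PowerSeries.coeff_mk, PowerSeries.coeff_mk, ← h]
  split_ifs with hi
  · rw [Nat.cast_sub hi]; push_cast; ring
  · rw [hilbertFn_neg _ (by omega : (i : ℤ) - d < 0)]; simp

theorem IsGradedCI.hilbertSeries_eq {J : Ideal (MvPolynomial (Fin n) K)} {ds : List ℕ}
    (h : IsGradedCI J ds) : hilbertSeries J = (ds.map fun d => 1 - PowerSeries.X ^ d).prod *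
      hilbertSeries (⊥ : Ideal (MvPolynomial (Fin n) K)) := by
  induction h with
  | bot => simp
  | sup h hf _ hreg ih =>
    rw [hilbertSeries_sup h.isGradedIdeal hf hreg, ih, List.map_cons, List.prod_cons, mul_assoc]

/-! ### From regular sequences of forms to graded complete intersections -/

theorem isSMulRegular_quotient_iff {J : Ideal (MvPolynomial (Fin n) K)}
    {f : MvPolynomial (Fin n) K} :
    IsSMulRegular (MvPolynomial (Fin n) K ⧸ (J • ⊤ : Submodule (MvPolynomial (Fin n) K)
      (MvPolynomial (Fin n) K))) f ↔ ∀ p, f * p ∈ J → p ∈ J := by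
  rw [isSMulRegular_iff_right_eq_zero_of_smul]
  constructor
  · intro h p hp
    have := h (Submodule.Quotient.mk p) ((Submodule.Quotient.mk_eq_zero _).2 (by simpa using hp))
    simpa using (Submodule.Quotient.mk_eq_zero _).1 this
  · intro h y hy
    obtain ⟨p, rfl⟩ := Submodule.Quotient.mk_surjective _ y
    rw [← Submodule.Quotient.mk_smul, Submodule.Quotient.mk_eq_zero] at hy
    rw [Submodule.Quotient.mk_eq_zero]
    simpa using h p (by simpa using hy)

theorem isWeaklyRegular_concat_iff {fs : List (MvPolynomial (Fin n) K)}
    {f : MvPolynomial (Fin n) K} :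
    RingTheory.Sequence.IsWeaklyRegular (MvPolynomial (Fin n) K) (fs ++ [f]) ↔
      RingTheory.Sequence.IsWeaklyRegular (MvPolynomial (Fin n) K) fs ∧
        ∀ p, f * p ∈ Ideal.ofList fs → p ∈ Ideal.ofList fs := by
  rw [RingTheory.Sequence.isWeaklyRegular_append_iff,
    RingTheory.Sequence.isWeaklyRegular_singleton_iff, isSMulRegular_quotient_iff]

theorem ofList_concat (fs : List (MvPolynomial (Fin n) K)) (f : MvPolynomial (Fin n) K) :
    Ideal.ofList (fs ++ [f]) = Ideal.ofList fs ⊔ Ideal.span {f} := by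
  rw [Ideal.ofList_append, Ideal.ofList_singleton]

/-- A weakly regular sequence of forms of positive degrees `deg f` gives a complete
intersection. -/
theorem isGradedCI_ofList {deg : MvPolynomial (Fin n) K → ℕ} {fs : List (MvPolynomial (Fin n) K)}
    (hfs : ∀ f ∈ fs, f.IsHomogeneous (deg f) ∧ 0 < deg f)
    (hreg : RingTheory.Sequence.IsWeaklyRegular (MvPolynomial (Fin n) K) fs) :
    IsGradedCI (Ideal.ofList fs) (fs.map deg).reverse := by
  induction fs using List.reverseRecOn with
  | nil => rw [Ideal.ofList_nil]; exact .bot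
  | append_singleton fs f ih =>
    obtain ⟨h1, h2⟩ := isWeaklyRegular_concat_iff.1 hreg
    have hf := hfs f (by simp)
    rw [ofList_concat, List.map_append, List.reverse_append]
    exact .sup (ih (fun g hg => hfs g (by simp [hg])) h1) hf.1 hf.2 h2

theorem exists_isGradedCI_of_isCompleteIntersection {I : Ideal (MvPolynomial (Fin n) K)}
    (hI : IsNondegenerate I) (hci : IsCompleteIntersection I) :
    ∃ ds : List ℕ, IsGradedCI I ds ∧ ∀ d ∈ ds, 2 ≤ d := by
  obtain ⟨fs, hhom, hreg, rfl⟩ := hci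
  have htop : Ideal.ofList fs ≠ ⊤ := fun h => hreg.top_ne_smul (by simp [h])
  -- `0` is regular only on the zero module, so then the preceding elements generate `S`
  have hne : ∀ f ∈ fs, f ≠ 0 := by
    rintro f hf rfl
    obtain ⟨l₁, l₂, rfl⟩ := List.append_of_mem hf
    have h1 := hreg.toIsWeaklyRegular
    rw [List.append_cons, RingTheory.Sequence.isWeaklyRegular_append_iff] at h1
    have h2 := (isWeaklyRegular_concat_iff.1 h1.1).2 1 (by simp)
    refine htop ((Ideal.eq_top_iff_one _).2 ?_)
    rw [Ideal.ofList_append]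
    exact Ideal.mem_sup_left h2
  choose! deg hdeg using hhom
  have hmem : ∀ f ∈ fs, f ∈ Ideal.ofList fs := fun f hf => Ideal.subset_span hf
  have h2 : ∀ f ∈ fs, 2 ≤ deg f := by
    intro f hf
    by_contra! hlt
    have h := hdeg f hf
    interval_cases hd : deg f
    -- a non-zero constant would generate the unit ideal
    · have h0 : f = C (coeff 0 f) := by
        rw [← homogeneousComponent_zero, homogeneousComponent_eq_self h]
      have hc : coeff 0 f ≠ 0 := fun hc => hne f hf (by rw [h0, hc, C_0])
      refine htop (Ideal.eq_top_of_isUnit_mem _ (hmem f hf) ?_)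
      rw [h0]
      exact (isUnit_iff_ne_zero.2 hc).map C
    · exact hne f hf (hI f (hmem f hf) h)
  refine ⟨_, isGradedCI_ofList (fun f hf => ⟨hdeg f hf, by have := h2 f hf; omega⟩)
    hreg.toIsWeaklyRegular, fun d hd => ?_⟩
  obtain ⟨f, hf, rfl⟩ := List.mem_map.1 (List.mem_reverse.1 hd)
  exact h2 f hf

/-! ### Powers of the variables -/

theorem mem_span_X_pow_iff {s : Set (Fin n)} {a : Fin n → ℕ} {p : MvPolynomial (Fin n) K} :
    p ∈ Ideal.span ((fun i => (X i : MvPolynomial (Fin n) K) ^ a i) '' s) ↔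
      ∀ m ∈ p.support, ∃ i ∈ s, a i ≤ m i := by
  have h : (fun i => (X i : MvPolynomial (Fin n) K) ^ a i) '' s =
      (fun m => monomial m (1 : K)) '' ((fun i => Finsupp.single i (a i)) '' s) := by
    rw [Set.image_image]
    simp only [X_pow_eq_monomial]
  rw [h, mem_ideal_span_monomial_image]
  simp only [Set.exists_mem_image, Finsupp.single_le_iff]

/-- `x_i^a` is a non-zero-divisor modulo powers of other variables. -/
theorem mem_span_X_pow_of_X_pow_mul_mem {s : Set (Fin n)} {a : Fin n → ℕ} {i : Fin n} (hi : i ∉ s)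
    {p : MvPolynomial (Fin n) K}
    (h : X i ^ a i * p ∈ Ideal.span ((fun i => (X i : MvPolynomial (Fin n) K) ^ a i) '' s)) :
    p ∈ Ideal.span ((fun i => (X i : MvPolynomial (Fin n) K) ^ a i) '' s) := by
  rw [mem_span_X_pow_iff] at h ⊢
  intro m hm
  obtain ⟨j, hj, hle⟩ := h (Finsupp.single i (a i) + m) (by
    rw [X_pow_eq_monomial, mem_support_iff, coeff_monomial_mul, one_mul]
    exact mem_support_iff.1 hm)
  have hij : i ≠ j := fun h => hi (h ▸ hj)
  exact ⟨j, hj, by simpa [Finsupp.single_eq_of_ne' hij] using hle⟩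

theorem ofList_map_X_pow (a : Fin n → ℕ) (l : List (Fin n)) :
    Ideal.ofList (l.map fun i => (X i : MvPolynomial (Fin n) K) ^ a i) =
      Ideal.span ((fun i => (X i : MvPolynomial (Fin n) K) ^ a i) '' {i | i ∈ l}) := by
  rw [Ideal.ofList]
  congr 1
  ext; simp

theorem isWeaklyRegular_X_pow (a : Fin n → ℕ) {l : List (Fin n)} (hl : l.Nodup) :
    RingTheory.Sequence.IsWeaklyRegular (MvPolynomial (Fin n) K)
      (l.map fun i => (X i : MvPolynomial (Fin n) K) ^ a i) := by
  induction l using List.reverseRecOn with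
  | nil => exact .nil _ _
  | append_singleton l i ih =>
    rw [List.nodup_append] at hl
    rw [List.map_append, List.map_singleton, isWeaklyRegular_concat_iff]
    refine ⟨ih hl.1, fun p => ?_⟩
    rw [ofList_map_X_pow]
    exact mem_span_X_pow_of_X_pow_mul_mem fun hi => hl.2.2 i hi i (by simp) rfl

theorem isGradedCI_X_pow {a : Fin n → ℕ} (ha : ∀ i, 0 < a i) {l : List (Fin n)} (hl : l.Nodup) :
    IsGradedCI (Ideal.ofList (l.map fun i => (X i : MvPolynomial (Fin n) K) ^ a i))
      (l.map a).reverse := by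
  have hdeg : ∀ i, totalDegree ((X i : MvPolynomial (Fin n) K) ^ a i) = a i := fun i =>
    totalDegree_X_pow i _
  have := isGradedCI_ofList (deg := totalDegree) (K := K)
    (fs := l.map fun i => (X i : MvPolynomial (Fin n) K) ^ a i) (fun f hf => ?_)
    (isWeaklyRegular_X_pow a hl)
  · simpa [List.map_map, Function.comp_def, hdeg] using this
  · obtain ⟨i, -, rfl⟩ := List.mem_map.1 hf
    rw [hdeg]
    exact ⟨isHomogeneous_X_pow i _, ha i⟩

/-! ### The Hilbert series of the polynomial ring -/

theorem hilbertSeries_irrelevant : hilbertSeries (irrelevant K n) = 1 := by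
  ext i
  rw [hilbertSeries, PowerSeries.coeff_mk, PowerSeries.coeff_one]
  split_ifs with hi
  · subst hi
    have h1 : quotPiece (irrelevant K n) ((0 : ℕ) : ℤ) =
        Submodule.span K {Ideal.Quotient.mk (irrelevant K n) 1} := by
      ext y
      rw [quotPiece_mem_iff, Submodule.mem_span_singleton]
      constructor
      · rintro ⟨p, hp, rfl⟩
        refine ⟨coeff 0 p, ?_⟩
        rw [← homogeneousComponent_eq_self (mem_polyPiece_natCast.1 hp), homogeneousComponent_zero,
          coeff_C, if_pos rfl, ← mul_one (C _), ← smul_eq_C_mul]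
        rfl
      · rintro ⟨c, rfl⟩
        exact ⟨c • 1, Submodule.smul_mem _ _ (isHomogeneous_one _ _), rfl⟩
    have h2 : Ideal.Quotient.mk (irrelevant K n) 1 ≠ 0 := by
      rw [Ne, Ideal.Quotient.eq_zero_iff_mem, mem_irrelevant_iff, map_one]
      exact one_ne_zero
    rw [hilbertFn, h1, finrank_span_singleton h2, Nat.cast_one]
  · have h1 : quotPiece (irrelevant K n) (i : ℤ) = ⊥ := by
      rw [eq_bot_iff]
      intro y hy
      obtain ⟨p, hp, rfl⟩ := quotPiece_mem_iff.1 hy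
      exact (Submodule.mem_bot K).2 (Ideal.Quotient.eq_zero_iff_mem.2 (mem_irrelevant_iff.2
        (constantCoeff_eq_zero_of_mem_polyPiece (by exact_mod_cast hi) hp)))
    rw [hilbertFn, h1, finrank_bot, Nat.cast_zero]

/-- The Hilbert series of `S` is `(1 - X)^{-n}`, because `x_1, …, x_n` is a regular sequence. -/
theorem one_sub_X_pow_mul_hilbertSeries_bot :
    (1 - PowerSeries.X) ^ n * hilbertSeries (⊥ : Ideal (MvPolynomial (Fin n) K)) = 1 := by
  have h := (isGradedCI_X_pow (K := K) (a := fun _ : Fin n => 1) (fun _ => one_pos)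
    (List.nodup_finRange n)).hilbertSeries_eq
  have hI : Ideal.ofList ((List.finRange n).map fun i => (X i : MvPolynomial (Fin n) K) ^ 1) =
      irrelevant K n := by
    rw [ofList_map_X_pow]
    simp [irrelevant, Set.image_univ]
  rw [hI, hilbertSeries_irrelevant] at h
  simpa [List.map_const'] using h.symm

theorem IsGradedCI.one_sub_X_pow_mul_hilbertSeries {J : Ideal (MvPolynomial (Fin n) K)}
    {ds : List ℕ} (h : IsGradedCI J ds) :
    (1 - PowerSeries.X) ^ n * hilbertSeries J =
      (ds.map fun d => 1 - PowerSeries.X ^ d).prod := by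
  rw [h.hilbertSeries_eq, mul_left_comm, one_sub_X_pow_mul_hilbertSeries_bot, mul_one]

/-! ### The degrees of the generators -/

/-- Only the second half of `HasHVector`: the entries of `l` may vanish. -/
theorem hilbertSeries_eq_iff {I : Ideal (MvPolynomial (Fin n) K)} (l : List ℕ) :
    hilbertSeries I = ((∑ i ∈ Finset.range l.length,
        Polynomial.monomial i (l.getD i 0 : ℤ) : Polynomial ℤ) : PowerSeries ℤ) ↔
      ∀ i : ℕ, hilbertFn I (i : ℤ) = l.getD i 0 := by
  rw [PowerSeries.ext_iff]
  refine forall_congr' fun i => ?_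
  rw [hilbertSeries, PowerSeries.coeff_mk, Polynomial.coeff_coe, Polynomial.finsetSum_coeff]
  simp only [Polynomial.coeff_monomial, Finset.sum_ite_eq', Finset.mem_range]
  split_ifs with h
  · exact Nat.cast_inj
  · rw [List.getD_eq_default l 0 (not_lt.1 h), Nat.cast_eq_zero]

/-- The power of `1 - X` dividing a polynomial is determined once the cofactor does not vanish at
`1`. -/
theorem eq_and_eq_of_one_sub_X_pow_mul_eq {p q : Polynomial ℤ} (hp : p.eval 1 ≠ 0)
    (hq : q.eval 1 ≠ 0) {a b : ℕ}
    (h : (1 - Polynomial.X) ^ a * p = (1 - Polynomial.X) ^ b * q) : a = b ∧ p = q := by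
  have hX : (1 - Polynomial.X : Polynomial ℤ) ≠ 0 := fun h0 => by
    simpa using congrArg (Polynomial.eval 0) h0
  wlog hab : a ≤ b generalizing a b p q
  · obtain ⟨h1, h2⟩ := this hq hp h.symm (by omega)
    exact ⟨h1.symm, h2.symm⟩
  obtain ⟨c, rfl⟩ := Nat.exists_eq_add_of_le hab
  rw [pow_add, mul_assoc] at h
  have h1 := mul_left_cancel₀ (pow_ne_zero a hX) h
  rcases Nat.eq_zero_or_pos c with rfl | hc
  · exact ⟨rfl, by simpa using h1⟩
  · exact absurd (by rw [h1]; simp [hc.ne']) hp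

/-- `1 + X + ⋯ + X^{d-1}`. -/
noncomputable def geomPoly (d : ℕ) : Polynomial ℤ := ∑ i ∈ Finset.range d, Polynomial.X ^ i

theorem coeff_geomPoly (d i : ℕ) : (geomPoly d).coeff i = if i < d then 1 else 0 := by
  simp [geomPoly, Polynomial.coeff_X_pow]

theorem prod_one_sub_X_pow (ds : List ℕ) :
    (ds.map fun d => (1 - Polynomial.X ^ d : Polynomial ℤ)).prod =
      (1 - Polynomial.X) ^ ds.length * (ds.map geomPoly).prod := by
  induction ds with
  | nil => simp
  | cons d ds ih =>
    rw [List.map_cons, List.prod_cons, ih, List.map_cons, List.prod_cons, List.length_cons,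
      ← mul_neg_geom_sum, ← geomPoly]
    ring

theorem eval_one_prod_geomPoly (ds : List ℕ) :
    (ds.map geomPoly).prod.eval 1 = (ds.prod : ℤ) := by
  induction ds with
  | nil => simp
  | cons d ds ih => simp [Polynomial.eval_mul, ih, geomPoly, Polynomial.eval_finsetSum]

theorem coeff_prod_geomPoly {ds : List ℕ} (h : ∀ d ∈ ds, 2 ≤ d) :
    (ds.map geomPoly).prod.coeff 0 = 1 ∧ (ds.map geomPoly).prod.coeff 1 = ds.length := by
  induction ds with
  | nil => simp [Polynomial.coeff_one]
  | cons d ds ih =>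
    obtain ⟨h0, h1⟩ := ih fun e he => h e (by simp [he])
    have hd := h d (by simp)
    rw [List.map_cons, List.prod_cons, Polynomial.mul_coeff_zero, Polynomial.mul_coeff_one, h0, h1,
      coeff_geomPoly, coeff_geomPoly, if_pos (by omega), if_pos (by omega)]
    simp

theorem natDegree_one_sub_X_pow (d : ℕ) :
    (1 - Polynomial.X ^ d : Polynomial ℤ).natDegree = d := by
  rw [← Polynomial.natDegree_neg, neg_sub, ← Polynomial.C_1, Polynomial.natDegree_X_pow_sub_C]

theorem one_sub_X_pow_ne_zero {d : ℕ} (hd : 0 < d) : (1 - Polynomial.X ^ d : Polynomial ℤ) ≠ 0 :=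
  fun h => by simpa [hd.ne'] using congrArg (Polynomial.eval 0) h

theorem natDegree_prod_one_sub_X_pow {ds : List ℕ} (h : ∀ d ∈ ds, 0 < d) :
    (ds.map fun d => (1 - Polynomial.X ^ d : Polynomial ℤ)).prod.natDegree = ds.sum := by
  induction ds with
  | nil => simp
  | cons d ds ih =>
    have h' : ∀ e ∈ ds, 0 < e := fun e he => h e (by simp [he])
    rw [List.map_cons, List.prod_cons, List.sum_cons, Polynomial.natDegree_mul, ih h',
      natDegree_one_sub_X_pow]
    · exact one_sub_X_pow_ne_zero (h d (by simp))
    · refine List.prod_ne_zero fun h0 => ?_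
      obtain ⟨e, he, h0⟩ := List.mem_map.1 h0
      exact one_sub_X_pow_ne_zero (h' e he) h0

theorem perm_of_length_of_sum {ds : List ℕ} (h2 : ∀ d ∈ ds, 2 ≤ d) (hlen : ds.length = 4)
    (hsum : ds.sum = 9) : ds.Perm [2, 2, 2, 3] := by
  obtain ⟨a, b, c, d, rfl⟩ := List.length_eq_four.1 hlen
  simp only [List.mem_cons, List.not_mem_nil, or_false, forall_eq_or_imp, forall_eq] at h2
  simp only [List.sum_cons, List.sum_nil] at hsum
  obtain ⟨ha, hb, hc, hd⟩ := h2
  have : (a = 2 ∧ b = 2 ∧ c = 2 ∧ d = 3) ∨ (a = 2 ∧ b = 2 ∧ c = 3 ∧ d = 2) ∨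
      (a = 2 ∧ b = 3 ∧ c = 2 ∧ d = 2) ∨ (a = 3 ∧ b = 2 ∧ c = 2 ∧ d = 2) := by omega
  rcases this with ⟨rfl, rfl, rfl, rfl⟩ | ⟨rfl, rfl, rfl, rfl⟩ | ⟨rfl, rfl, rfl, rfl⟩ |
    ⟨rfl, rfl, rfl, rfl⟩ <;> decide

theorem sum_hVector (k : ℕ) :
    (∑ i ∈ Finset.range [1, 4, k, k, 4, 1].length,
      Polynomial.monomial i (([1, 4, k, k, 4, 1].getD i 0 : ℕ) : ℤ) : Polynomial ℤ) =
      1 + 4 * Polynomial.X + (k : Polynomial ℤ) * Polynomial.X ^ 2 +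
        (k : Polynomial ℤ) * Polynomial.X ^ 3 + 4 * Polynomial.X ^ 4 + Polynomial.X ^ 5 := by
  simp [Finset.sum_range_succ, ← Polynomial.C_mul_X_pow_eq_monomial]

/-- The only degrees compatible with an `H`-vector `(1, 4, k, k, 4, 1)` are `2, 2, 2, 3`, and then
`k = 7`. -/
theorem IsGradedCI.perm_and_eq {I : Ideal (MvPolynomial (Fin n) K)} {ds : List ℕ} {k : ℕ}
    (h : IsGradedCI I ds) (h2 : ∀ d ∈ ds, 2 ≤ d) (hH : HasHVector I [1, 4, k, k, 4, 1]) :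
    ds.Perm [2, 2, 2, 3] ∧ k = 7 := by
  set p : Polynomial ℤ := 1 + 4 * Polynomial.X + (k : Polynomial ℤ) * Polynomial.X ^ 2 +
    (k : Polynomial ℤ) * Polynomial.X ^ 3 + 4 * Polynomial.X ^ 4 + Polynomial.X ^ 5 with hp
  have hpos : ∀ d ∈ ds, 0 < d := fun d hd => by have := h2 d hd; omega
  have hS := (hilbertSeries_eq_iff _).2 hH.2
  rw [sum_hVector, ← hp] at hS
  have hprod : (1 - Polynomial.X) ^ n * p =
      (ds.map fun d => (1 - Polynomial.X ^ d : Polynomial ℤ)).prod := by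
    have h1 := h.one_sub_X_pow_mul_hilbertSeries
    rw [hS] at h1
    apply Polynomial.coe_injective (R := ℤ)
    rw [← Polynomial.coeToPowerSeries.ringHom_apply, ← Polynomial.coeToPowerSeries.ringHom_apply,
      map_list_prod, List.map_map]
    simpa [Function.comp_def] using h1
  have hp1 : p.eval 1 = 10 + 2 * k := by
    simp [hp]
    ring
  have hq1 : (ds.prod : ℤ) ≠ 0 := by
    exact_mod_cast List.prod_ne_zero fun h0 => absurd (hpos 0 h0) (lt_irrefl 0)
  obtain ⟨hn, hpq⟩ := eq_and_eq_of_one_sub_X_pow_mul_eq (by rw [hp1]; positivity)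
    (by rwa [eval_one_prod_geomPoly]) (hprod.trans (prod_one_sub_X_pow ds))
  have hlen : ds.length = 4 := by
    have h1 : p.coeff 1 = 4 := by
      rw [hp, ← sum_hVector]
      simp [Polynomial.coeff_monomial]
    rw [hpq, (coeff_prod_geomPoly h2).2] at h1
    exact_mod_cast h1
  have hdeg : p.natDegree = 5 := by
    rw [hp]
    compute_degree!
  have hsum : ds.sum = 9 := by
    rw [← natDegree_prod_one_sub_X_pow hpos, ← hprod, Polynomial.natDegree_mul, hdeg,
      Polynomial.natDegree_pow, hn, hlen]
    · simpa using natDegree_one_sub_X_pow 1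
    · exact pow_ne_zero _ (by simpa using one_sub_X_pow_ne_zero one_pos)
    · intro h0
      rw [h0] at hdeg
      simp at hdeg
  have hperm := perm_of_length_of_sum h2 hlen hsum
  refine ⟨hperm, ?_⟩
  have h24 : ds.prod = 24 := by rw [hperm.prod_eq]; rfl
  have h1 := eval_one_prod_geomPoly ds
  rw [← hpq, hp1, h24] at h1
  push_cast at h1
  omega

/-! ### The Betti table -/

theorem koszulBetti_eq_tableEntry (i : ℕ) (j : ℤ) :
    koszulBetti [2, 2, 2, 3] i (i + j) = tableEntry koszulTable2223 i j := by
  by_cases hj : 0 ≤ j ∧ j < 6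
  · obtain ⟨h0, h6⟩ := hj
    rcases i with _ | _ | _ | _ | _ | i
    · interval_cases j <;> rfl
    · interval_cases j <;> rfl
    · interval_cases j <;> rfl
    · interval_cases j <;> rfl
    · interval_cases j <;> rfl
    · simp [koszulBetti, tableEntry]
  · have ht : tableEntry koszulTable2223 i j = 0 := by
      rw [tableEntry, dif_neg (by omega)]
    rw [ht]
    rcases i with _ | _ | _ | _ | _ | i <;> simp [koszulBetti] <;> omega

theorem IsGradedCI.hasBettiTable {I : Ideal (MvPolynomial (Fin n) K)} {ds : List ℕ}
    (h : IsGradedCI I ds) (hds : ds.Perm [2, 2, 2, 3]) : HasBettiTable I koszulTable2223 := by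
  refine ⟨⟨h.exists_resolution.choose⟩, fun F i j => ?_⟩
  rw [h.betti_eq, koszulBetti_perm hds, koszulBetti_eq_tableEntry]

theorem IsGradedCI.hasTotalBettiNumbers {I : Ideal (MvPolynomial (Fin n) K)} {ds : List ℕ}
    (h : IsGradedCI I ds) (hds : ds.length = 4) : HasTotalBettiNumbers I [1, 4, 6, 4, 1] := by
  refine ⟨⟨h.exists_resolution.choose⟩, fun F i => ?_⟩
  rw [h.rank_eq, hds]
  rcases i with _ | _ | _ | _ | _ | i
  all_goals rfl

/-! ### The ideal `(x_1^2, x_2^2, x_3^2, x_4^3)` -/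

theorem monomialCI_eq_ofList (K : Type*) [Field K] :
    monomialCI K = Ideal.ofList ((List.finRange 4).map fun i => (X i : MvPolynomial (Fin 4) K) ^
      (![2, 2, 2, 3] : Fin 4 → ℕ) i) := by
  rw [monomialCI, Ideal.ofList]
  congr 1
  ext p
  simp [List.finRange_succ]

theorem isGradedCI_monomialCI (K : Type*) [Field K] : IsGradedCI (monomialCI K) [3, 2, 2, 2] := by
  rw [monomialCI_eq_ofList]
  exact isGradedCI_X_pow (a := ![2, 2, 2, 3]) (by decide) (List.nodup_finRange 4)

theorem hasHVector_monomialCI (K : Type*) [Field K] :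
    HasHVector (monomialCI K) [1, 4, 7, 7, 4, 1] := by
  refine ⟨by simp, (hilbertSeries_eq_iff _).1 ?_⟩
  rw [sum_hVector]
  have h := (isGradedCI_monomialCI K).one_sub_X_pow_mul_hilbertSeries
  have hX : (1 - PowerSeries.X : PowerSeries ℤ) ≠ 0 := fun h0 => by
    simpa using congrArg PowerSeries.constantCoeff h0
  apply mul_left_cancel₀ (pow_ne_zero 4 hX)
  have hmap : Polynomial.coeToPowerSeries.ringHom (Polynomial.X : Polynomial ℤ) =
      PowerSeries.X := Polynomial.coe_X
  rw [h, ← Polynomial.coeToPowerSeries.ringHom_apply]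
  simp only [map_add, map_mul, map_pow, map_one, map_ofNat, map_natCast, hmap, List.map_cons,
    List.map_nil, List.prod_cons, List.prod_nil]
  push_cast
  ring

theorem isNondegenerate_monomialCI (K : Type*) [Field K] : IsNondegenerate (monomialCI K) := by
  intro l hl hhom
  rw [monomialCI_eq_ofList, ofList_map_X_pow, mem_span_X_pow_iff] at hl
  by_contra hne
  obtain ⟨m, hm⟩ := support_nonempty.2 hne
  obtain ⟨i, -, hi⟩ := hl m hm
  have h1 : m.degree = 1 := by
    by_contra h
    exact mem_support_iff.1 hm (hhom.coeff_eq_zero h)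
  have h2 : m i ≤ m.degree := Finsupp.le_degree i m
  have h3 : ∀ i : Fin 4, 2 ≤ (![2, 2, 2, 3] : Fin 4 → ℕ) i := by decide
  have := h3 i
  omega

theorem isCompleteIntersection_monomialCI (K : Type*) [Field K] :
    IsCompleteIntersection (monomialCI K) := by
  refine ⟨_, fun f hf => ?_, ⟨isWeaklyRegular_X_pow ![2, 2, 2, 3] (List.nodup_finRange 4), ?_⟩,
    monomialCI_eq_ofList K⟩
  · obtain ⟨i, -, rfl⟩ := List.mem_map.1 hf
    exact ⟨_, isHomogeneous_X_pow i _⟩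
  · rw [← monomialCI_eq_ofList]
    intro h
    have h1 : (1 : MvPolynomial (Fin 4) K) ∈ monomialCI K := by
      have h0 : (1 : MvPolynomial (Fin 4) K) ∈ (monomialCI K •
          (⊤ : Submodule (MvPolynomial (Fin 4) K) (MvPolynomial (Fin 4) K))) := h ▸ trivial
      simpa using h0
    have h2 : monomialCI K ≤ irrelevant K 4 := by
      rw [monomialCI, Ideal.span_le]
      rintro _ (rfl | rfl | rfl | rfl) <;> exact mem_irrelevant_iff.2 (by simp)
    simpa using mem_irrelevant_iff.1 (h2 h1)

end

theorem theorem4p2 (K : Type*) [Field K] [CharZero K] :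
    (∀ (n k : ℕ) (I : Ideal (MvPolynomial (Fin n) K)),
      IsNondegenerate I → IsCompleteIntersection I → HasHVector I [1, 4, k, k, 4, 1] →
        HasHVector I [1, 4, 7, 7, 4, 1] ∧
        HasBettiTable I koszulTable2223 ∧
        HasTotalBettiNumbers I [1, 4, 6, 4, 1]) ∧
    (IsNondegenerate (monomialCI K) ∧
      IsCompleteIntersection (monomialCI K) ∧
      HasHVector (monomialCI K) [1, 4, 7, 7, 4, 1] ∧
      HasBettiTable (monomialCI K) koszulTable2223) := by
  refine ⟨fun n k I hI hci hH => ?_, isNondegenerate_monomialCI K,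
    isCompleteIntersection_monomialCI K, hasHVector_monomialCI K,
    (isGradedCI_monomialCI K).hasBettiTable (by decide)⟩
  obtain ⟨ds, hds, h2⟩ := exists_isGradedCI_of_isCompleteIntersection hI hci
  obtain ⟨hperm, rfl⟩ := hds.perm_and_eq h2 hH
  exact ⟨hH, hds.hasBettiTable hperm, hds.hasTotalBettiNumbers hperm.length_eq⟩
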